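/- Fix $\lambda_P>0$ and $m>0$. **Quantum spacetime.** Let $\Sigma$ be the set of real antisymmetric $4\times4$ matrices $\sigma^{\mu\nu}$ with $\sigma_{\mu\nu}\sigma^{\mu\nu}=0$ and $\big(\tfrac12\sigma_{\mu\nu}\sigma_{\rho\tau}\epsilon^{\mu\nu\rho\tau}\big)^2=16\lambda_P^8$, and write $k\sigma k'=k_\mu\sigma^{\mu\nu}k'_\nu$. The Weyl operators satisfy $e^{i\alpha q}e^{i\beta q}=e^{-\frac i2\alpha Q\beta}e^{i(\alpha+\beta)q}$, where the commutators $Q$ are central with joint spectrum $\Sigma$. A state $\omega$ on quantum spacetime is given by a probability measure $\mu$ on $\Sigma$ and a measurable field $(\omega_\sigma)_{\sigma\in\Sigma}$ of regular states on the fibres (where $Q=\sigma$). **Free field.** Let $d\mu_m(k)=(2\pi)^{-3}\frac{d\mathbf k}{2\omega_{\mathbf k}}\big|_{k_0=\omega_{\mathbf k}}$, $\omega_{\mathbf k}=\sqrt{m^2+\mathbf k^2}$, be the invariant measure on the mass shell, and let $\varphi$ be the free scalar field of mass $m$ on Minkowski space, acting on the finite particle vectors with Schwartz wave functions in its Fock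 space. For a finite ordered set $B$ let $\varphi^{\otimes|B|}(F)=\int dx_B\,F(x_B)\prod_{b\in B}\varphi(x_b)$ (product in the order of $B$), and let $\check f(k_B)=(2\pi)^{-4|B|}\int dx_B\,f(x_B)\,e^{-i\sum_b k_bx_b}$. **Contractions.** A contraction $C$ in a finite ordered set $N$ is a subset $A\subset N$ with an injective map $\alpha:A\to N\setminus A$ such that $\alpha(a)>a$ for all $a\in A$; let $U=N\setminus(A\cup\alpha(A))$. The intersection matrix $I$ and the enclosure matrix $E$ have the $4\times4$ blocks $I_{aa'}=Q$ if $a<a'<\alpha(a)<\alpha(a')$, $E_{au}=Q$ if $a<u<\alpha(a)$, and $0$ otherwise ($a,a'\in A$, $u\in U$). The connected components of $C$ are those of the graph on $A$ in which $a,a'$ are adjacent if $I_{aa'}\neq0$ or $I_{a'a}\neq0$; each component is itself a contraction in $N$. A contraction is *quasiplanar* if its enclosure matrix vanishes; $\mathcal C_{qp}(N)$ is the set of contractions all of whose connected components, each regarded as a contraction in $N$, are quasiplanar. A contraction is *aplanar* if for every connected component the corresponding part of $E$ (rows $a$ in the component, columns $u\in U$) is nonzero; $\mathcal C_{ap}(N)$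 is the set of aplanar contractions in $N$. The empty contraction belongs to both. The contraction map $\gamma_0^C$ and the quantum contraction $\gamma^C$ are given by $$\check{(\gamma_0^C f)}(k_U)=(2\pi)^{8|A|}\int\prod_{a\in A}d\mu_m(k_a)\;\check f(k_N)\big|_{k_{\alpha(A)}=-k_A},$$ $$\check{(\gamma^C f)}(k_U)=(2\pi)^{8|A|}\int\prod_{a\in A}d\mu_m(k_a)\;e^{-i\langle k_A,Ik_A\rangle-i\langle k_A,Ek_U\rangle}\,\check f(k_N)\big|_{k_{\alpha(A)}=-k_A},$$ the latter as a function of $\sigma\in\Sigma$ (insert $Q=\sigma$). **Products of fields.** For a test function $g=(g_\sigma)_{\sigma\in\Sigma}$ of the variables $x_B$ let $\phi^{|B|}_g(\omega)=\varphi^{\otimes|B|}(F)$ and $:\!\phi^{|B|}_g\!:(\omega)=\;:\!\varphi^{\otimes|B|}\!:(F)$, where $\check F(k_B)=\int d\mu(\sigma)\,\omega_\sigma\big(\prod_{b\in B}e^{-ik_bq}\big)\,\check g_\sigma(k_B)$ and $$:\!\varphi^{\otimes|B|}\!:\;=\sum_{C\in\mathcal C(B)}(-1)^{|A|}\,\varphi^{\otimes|U|}\circ\gamma_0^C$$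 is the ordinary Wick product, $\mathcal C(B)$ being the set of all contractions in $B$. The quasiplanar Wick product of $f\in\mathcal S(\mathbb R^{4|N|})$ is $$:\!\phi^{|N|}_f\!:_{qp}\;=\sum_{C\in\mathcal C_{qp}(N)}(-1)^{\kappa}\,\phi^{|U|}_{\gamma^C(f)},$$ where $\kappa$ is the number of connected components of $C$. **Claim.** For every finite ordered set $N$, every $f\in\mathcal S(\mathbb R^{4|N|})$ and every state $\omega$, $$:\!\phi^{|N|}_f\!:_{qp}(\omega)\;=\sum_{C\in\mathcal C_{ap}(N)}:\!\phi^{|U|}_{\gamma^C(f)}\!:(\omega).$$ -/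

import Mathlib

noncomputable section

namespace NCWick

/-! ### Minkowski space and the noncommutativity matrices -/

/-- Vectors of Minkowski space, given by their contravariant components. -/
abbrev R4 : Type := Fin 4 → ℝ

/-- Spatial momenta. -/
abbrev R3 : Type := Fin 3 → ℝ

/-- The diagonal of the Minkowski metric, signature `(+,-,-,-)`. -/
def eta : Fin 4 → ℝ := ![1, -1, -1, -1]

/-- Lowering an index. -/
def lower (k : R4) : R4 := fun μ => eta μ * k μ

/-- The Minkowski product `k x = k_μ x^μ`. -/
def mdot (k x : R4) : ℝ := ∑ μ, lower k μ * x μ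

/-- `k σ k' = k_μ σ^{μν} k'_ν`. -/
def twist (σ : Fin 4 → Fin 4 → ℝ) (k k' : R4) : ℝ :=
  ∑ μ, ∑ ν, lower k μ * σ μ ν * lower k' ν

/-- `σ_{μν} σ^{μν}`. -/
def sqInvariant (σ : Fin 4 → Fin 4 → ℝ) : ℝ :=
  ∑ μ, ∑ ν, (eta μ * eta ν * σ μ ν) * σ μ ν

/-- `(1/2) σ_{μν} σ_{ρτ} ε^{μνρτ}`; the totally antisymmetric tensor is written as a signed sum
over permutations. -/
def dualInvariant (σ : Fin 4 → Fin 4 → ℝ) : ℝ :=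
  (1 / 2) * ∑ π : Equiv.Perm (Fin 4), ((Equiv.Perm.sign π : ℤ) : ℝ) *
    (eta (π 0) * eta (π 1) * σ (π 0) (π 1)) * (eta (π 2) * eta (π 3) * σ (π 2) (π 3))

/-- The joint spectrum `Σ` of the commutators `Q^{μν}`, as fixed by the quantum conditions with
Planck length `lam`. -/
def QSpec (lam : ℝ) : Set (Fin 4 → Fin 4 → ℝ) :=
  {σ | (∀ μ ν, σ μ ν = -σ ν μ) ∧ sqInvariant σ = 0 ∧ dualInvariant σ ^ 2 = 16 * lam ^ 8}

/-! ### Weyl operators and states -/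

/-- The element `coeff • e^{i mom q}` of the algebra of quantum spacetime, in the fibre over the
spectral value `σ` of the commutators `Q`. -/
@[ext]
structure WeylMonomial (σ : Fin 4 → Fin 4 → ℝ) where
  coeff : ℂ
  mom : R4

/-- The Weyl relation `e^{iαq} e^{iβq} = e^{-(i/2) α σ β} e^{i(α+β)q}`. -/
instance (σ : Fin 4 → Fin 4 → ℝ) : Mul (WeylMonomial σ) where
  mul x y := ⟨x.coeff * y.coeff *
    Complex.exp (-(Complex.I / 2) * (twist σ x.mom y.mom : ℂ)), x.mom + y.mom⟩

instance (σ : Fin 4 → Fin 4 → ℝ) : One (WeylMonomial σ) where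
  one := ⟨1, 0⟩

instance (σ : Fin 4 → Fin 4 → ℝ) : Star (WeylMonomial σ) where
  star x := ⟨star x.coeff, -x.mom⟩

theorem twist_zero_left (σ : Fin 4 → Fin 4 → ℝ) (k : R4) : twist σ 0 k = 0 := by
  simp [twist, lower]

theorem twist_zero_right (σ : Fin 4 → Fin 4 → ℝ) (k : R4) : twist σ k 0 = 0 := by
  simp [twist, lower]

theorem twist_add_left (σ : Fin 4 → Fin 4 → ℝ) (k l p : R4) :
    twist σ (k + l) p = twist σ k p + twist σ l p := by
  simp [twist, lower, mul_add, add_mul, Finset.sum_add_distrib]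

theorem twist_add_right (σ : Fin 4 → Fin 4 → ℝ) (k l p : R4) :
    twist σ k (l + p) = twist σ k l + twist σ k p := by
  simp [twist, lower, mul_add, Finset.sum_add_distrib]

instance (σ : Fin 4 → Fin 4 → ℝ) : Monoid (WeylMonomial σ) where
  mul_assoc x y z := by
    apply WeylMonomial.ext
    · change x.coeff * y.coeff * Complex.exp (-(Complex.I / 2) * (twist σ x.mom y.mom : ℂ)) *
          z.coeff * Complex.exp (-(Complex.I / 2) * (twist σ (x.mom + y.mom) z.mom : ℂ)) =
        x.coeff * (y.coeff * z.coeff *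
          Complex.exp (-(Complex.I / 2) * (twist σ y.mom z.mom : ℂ))) *
          Complex.exp (-(Complex.I / 2) * (twist σ x.mom (y.mom + z.mom) : ℂ))
      rw [twist_add_left, twist_add_right]
      push_cast
      simp only [mul_add, Complex.exp_add]
      ring
    · exact add_assoc x.mom y.mom z.mom
  one_mul x := by
    apply WeylMonomial.ext
    · change 1 * x.coeff * Complex.exp (-(Complex.I / 2) * (twist σ 0 x.mom : ℂ)) = x.coeff
      simp [twist_zero_left]
    · exact zero_add x.mom
  mul_one x := by
    apply WeylMonomial.ext
    · change x.coeff * 1 * Complex.exp (-(Complex.I / 2) * (twist σ x.mom 0 : ℂ)) = x.coeff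
      simp [twist_zero_right]
    · exact add_zero x.mom

/-- The Weyl operator `e^{ikq}` in the fibre over `σ`. -/
def expq (σ : Fin 4 → Fin 4 → ℝ) (k : R4) : WeylMonomial σ := ⟨1, k⟩

/-- The value on a Weyl monomial of the linear functional with `e^{ikq} ↦ χ k`. -/
def evalWeyl {σ : Fin 4 → Fin 4 → ℝ} (χ : R4 → ℂ) (x : WeylMonomial σ) : ℂ := x.coeff * χ x.mom

/-- A state `μ ∘ ω` on the algebra of quantum spacetime: a probability measure `μ` on `Σ` and a
`Z`-valued state `ω`, i.e. a measurable field of regular states on the fibres over `σ ∈ Σ`. The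
state in the fibre over `σ` is given by its values `χ σ k = ω_σ(e^{ikq})` on the Weyl operators. -/
structure QState (lam : ℝ) where
  μ : MeasureTheory.Measure (QSpec lam)
  isProb : MeasureTheory.IsProbabilityMeasure μ
  χ : QSpec lam → R4 → ℂ
  measurable : ∀ k, Measurable fun σ => χ σ k
  regular : ∀ σ, Continuous (χ σ)
  unital : ∀ σ, evalWeyl (χ σ) (1 : WeylMonomial σ.1) = 1
  /-- `ω_σ(A* A) ≥ 0` for `A = ∑ c_j e^{i k_j q}`. -/
  positive : ∀ (σ : QSpec lam) (n : ℕ) (c : Fin n → ℂ) (k : Fin n → R4),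
    ∃ r : ℝ, 0 ≤ r ∧ ∑ i, ∑ j, star (c i) * c j *
      evalWeyl (χ σ) (star (expq σ.1 (k i)) * expq σ.1 (k j)) = (r : ℂ)

/-! ### Finite ordered sets and contractions -/

/-- The increasing enumeration of a finite ordered set. -/
def enum (B : Type*) [LinearOrder B] [Fintype B] : Fin (Fintype.card B) ≃o B :=
  monoEquivOfFin B rfl

/-- A contraction in the finite ordered set `N`: a subset `A` and an injective map
`α : A → N \ A` with `α a > a`. -/
@[ext]
structure Contraction (N : Type*) [LinearOrder N] [Fintype N] where
  A : Finset N
  α : A → N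
  injective : Function.Injective α
  notMem : ∀ a, α a ∉ A
  lt : ∀ a : A, (a : N) < α a

namespace Contraction

variable {N : Type*} [LinearOrder N] [Fintype N]

theorem finite_contraction : Finite (Contraction N) := by
  refine Finite.of_injective
    (fun C : Contraction N => (⟨C.A, C.α⟩ : Σ A : Finset N, (A → N))) ?_
  rintro ⟨A, α, _, _, _⟩ ⟨A', α', _, _, _⟩ h
  obtain ⟨rfl, h2⟩ := Sigma.mk.inj_iff.mp h
  cases h2
  rfl

instance : Fintype (Contraction N) := @Fintype.ofFinite _ finite_contraction

/-- The set `U = N \ (A ∪ α(A))` of uncontracted indices. -/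
def U (C : Contraction N) : Finset N := (C.A ∪ Finset.univ.image C.α)ᶜ

/-- `a < a' < α(a) < α(a')`: the internal lines starting in `a` and `a'` intersect. -/
def Intersects (C : Contraction N) (a a' : C.A) : Prop :=
  (a : N) < a' ∧ (a' : N) < C.α a ∧ C.α a < C.α a'

/-- `a < u < α(a)`: the external line of `u` is crossed by the internal line starting in `a`. -/
def Encloses (C : Contraction N) (a : C.A) (u : C.U) : Prop :=
  (a : N) < u ∧ (u : N) < C.α a

open scoped Classical in
/-- The intersection matrix `I`, with `4 × 4` blocks `I_{aa'}` equal to `σ` or `0`. -/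
def intersectionMatrix (C : Contraction N) (σ : Fin 4 → Fin 4 → ℝ) :
    Matrix (C.A × Fin 4) (C.A × Fin 4) ℝ :=
  fun x y => if C.Intersects x.1 y.1 then σ x.2 y.2 else 0

open scoped Classical in
/-- The enclosure matrix `E`, with `4 × 4` blocks `E_{au}` equal to `σ` or `0`. -/
def enclosureMatrix (C : Contraction N) (σ : Fin 4 → Fin 4 → ℝ) :
    Matrix (C.A × Fin 4) (C.U × Fin 4) ℝ :=
  fun x y => if C.Encloses x.1 y.1 then σ x.2 y.2 else 0

/-- For every `σ ∈ Σ` the block `E_{au}` is nonzero exactly if `a < u < α(a)`. -/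
theorem enclosureMatrix_block_ne_zero_iff (C : Contraction N) {lam : ℝ} (hlam : 0 < lam)
    (σ : QSpec lam) (a : C.A) (u : C.U) :
    (∃ μ ν, C.enclosureMatrix σ.1 (a, μ) (u, ν) ≠ 0) ↔ C.Encloses a u := by
  classical
  constructor
  · rintro ⟨μ, ν, h⟩
    by_contra hn
    exact h (by simp [enclosureMatrix, hn])
  · intro h
    by_contra! hn
    have h0 : ∀ μ ν, σ.1 μ ν = 0 := by
      intro μ ν
      simpa [enclosureMatrix, h] using hn μ ν
    have h1 := σ.2.2.2
    simp only [dualInvariant, h0, mul_zero, Finset.sum_const_zero] at h1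
    have h2 : 0 < lam ^ 8 := by positivity
    nlinarith

/-- The graph on `A` in which two internal lines are adjacent if they intersect. -/
def lineGraph (C : Contraction N) : SimpleGraph C.A := SimpleGraph.fromRel C.Intersects

/-- The connected components of a contraction. -/
abbrev Component (C : Contraction N) : Type _ := C.lineGraph.ConnectedComponent

open scoped Classical in
/-- A connected component, regarded as a contraction in `N` of its own. -/
def component (C : Contraction N) (K : C.Component) : Contraction N where
  A := C.A.filter fun n => ∃ h : n ∈ C.A, C.lineGraph.connectedComponentMk ⟨n, h⟩ = K
  α a := C.α ⟨a, (Finset.mem_filter.mp a.2).1⟩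
  injective a b h := by
    have h1 := C.injective h
    exact Subtype.ext (congrArg (fun x : C.A => (x : N)) h1)
  notMem a h := C.notMem _ (Finset.mem_filter.mp h).1
  lt a := C.lt ⟨a, (Finset.mem_filter.mp a.2).1⟩

/-- The number `κ` of connected components. -/
def kappa (C : Contraction N) : ℕ := Nat.card C.Component

/-- A contraction is quasiplanar if its enclosure matrix vanishes. -/
def IsQuasiplanar (C : Contraction N) : Prop := ∀ (a : C.A) (u : C.U), ¬ C.Encloses a u

/-- The set `C_qp(N)`: all connected components, each regarded as a contraction in `N`, are
quasiplanar. -/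
def MemQP (C : Contraction N) : Prop := ∀ K : C.Component, (C.component K).IsQuasiplanar

/-- The set `C_ap(N)` of aplanar contractions: for every connected component, the corresponding
part (rows `a` in the component, columns `u ∈ U`) of the enclosure matrix is nontrivial. -/
def IsAplanar (C : Contraction N) : Prop :=
  ∀ K : C.Component, ∃ a : C.A, C.lineGraph.connectedComponentMk a = K ∧
    ∃ u : C.U, C.Encloses a u

open scoped Classical in
/-- The tuple `k_N` with prescribed `k_A` and `k_U` and with `k_{α(A)} = -k_A`. -/
def assemble (C : Contraction N) (kA : C.A → R4) (kU : C.U → R4) : N → R4 := fun n =>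
  if h : n ∈ C.U then kU ⟨n, h⟩
  else if h : n ∈ C.A then kA ⟨n, h⟩
  else if h : ∃ a, C.α a = n then -kA h.choose
  else 0

end Contraction

/-! ### The mass shell and the contraction maps

Test functions `f` are represented by their inverse Fourier transforms `f̌`. -/

/-- `ω_p = √(m² + p²)`. -/
def energy (m : ℝ) (p : R3) : ℝ := Real.sqrt (m ^ 2 + ∑ i, p i ^ 2)

/-- The point `(ω_p, p)` of the positive mass shell. -/
def onShell (m : ℝ) (p : R3) : R4 := Fin.cons (energy m p) p

/-- The Lorentz invariant measure `(2π)^{-3} dp / (2 ω_p)` on the mass shell, parametrized by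
spatial momenta. -/
def shell (m : ℝ) : MeasureTheory.Measure R3 :=
  MeasureTheory.Measure.withDensity MeasureTheory.volume
    fun p => ENNReal.ofReal ((2 * Real.pi) ^ (-3 : ℤ) * (1 / (2 * energy m p)))

/-- The inverse Fourier transform
`f̌(k_B) = (2π)^{-4|B|} ∫ dx_B f(x_B) e^{-i ∑ k_b x_b}`. -/
def invFourier {B : Type*} [Fintype B] (f : (B → R4) → ℂ) (k : B → R4) : ℂ :=
  ((2 * Real.pi : ℝ) : ℂ) ^ (-(4 * (Fintype.card B : ℤ))) *
    ∫ x : B → R4, f x * Complex.exp (-Complex.I * ((∑ b, mdot (k b) (x b) : ℝ) : ℂ))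

namespace Contraction

variable {N : Type*} [LinearOrder N] [Fintype N]

/-- The ordinary contraction map `γ_0^C`, in Fourier space. -/
def gamma0 (C : Contraction N) (m : ℝ) (g : (N → R4) → ℂ) (kU : C.U → R4) : ℂ :=
  ((2 * Real.pi : ℝ) : ℂ) ^ (8 * C.A.card) *
    ∫ p : C.A → R3, g (C.assemble (fun a => onShell m (p a)) kU)
      ∂(MeasureTheory.Measure.pi fun _ => shell m)

open scoped Matrix in
/-- The phase `⟨k_A, I k_A⟩ + ⟨k_A, E k_U⟩`. -/
def phase (C : Contraction N) (σ : Fin 4 → Fin 4 → ℝ) (kA : C.A → R4) (kU : C.U → R4) : ℝ :=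
  (fun x : C.A × Fin 4 => lower (kA x.1) x.2) ⬝ᵥ
      (C.intersectionMatrix σ *ᵥ fun x : C.A × Fin 4 => lower (kA x.1) x.2) +
    (fun x : C.A × Fin 4 => lower (kA x.1) x.2) ⬝ᵥ
      (C.enclosureMatrix σ *ᵥ fun x : C.U × Fin 4 => lower (kU x.1) x.2)

/-- The quantum contraction `γ^C`, in Fourier space, in the fibre over `σ`. -/
def gamma (C : Contraction N) (m : ℝ) (g : (N → R4) → ℂ) (σ : Fin 4 → Fin 4 → ℝ)
    (kU : C.U → R4) : ℂ :=
  ((2 * Real.pi : ℝ) : ℂ) ^ (8 * C.A.card) *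
    ∫ p : C.A → R3,
      Complex.exp (-Complex.I * (C.phase σ (fun a => onShell m (p a)) kU : ℂ)) *
        g (C.assemble (fun a => onShell m (p a)) kU)
      ∂(MeasureTheory.Measure.pi fun _ => shell m)

end Contraction

/-! ### The free field on Fock space -/

/-- Sequences of `n`-particle wave functions on the mass shell. -/
abbrev FockFn : Type := (n : ℕ) → (Fin n → R3) → ℂ

/-- The dense domain of finite particle vectors in the bosonic Fock space over the mass shell
whose wave functions are Schwartz functions. -/
structure FockDomain where
  comp : (n : ℕ) → SchwartzMap (Fin n → R3) ℂ
  symm : ∀ (n : ℕ) (π : Equiv.Perm (Fin n)) (p : Fin n → R3), comp n (p ∘ π) = comp n p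
  finite : ∃ M, ∀ n, M ≤ n → comp n = 0

/-- Operators defined on the domain. -/
abbrev FockOp : Type := FockDomain → FockFn

/-- Annihilation part of `∫ dx φ(x) F(x)`, for a vector-valued `Ψ = F̌` :
`∫ dμ(k) a(k) Ψ(k)`, where `[a(k), a*(k')]` is the delta function with respect to `dμ`. -/
def annih (m : ℝ) (Ψ : R4 → FockFn) : FockFn := fun n p =>
  (Real.sqrt (n + 1) : ℂ) * ∫ q : R3, Ψ (onShell m q) (n + 1) (Fin.cons q p) ∂(shell m)

/-- Creation part of `∫ dx φ(x) F(x)`, for a vector-valued `Ψ = F̌` :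
`∫ dμ(k) a*(k) Ψ(-k)`. -/
def create (m : ℝ) (Ψ : R4 → FockFn) : FockFn
  | 0, _ => 0
  | n + 1, p => (1 / Real.sqrt (n + 1) : ℂ) *
      ∑ j : Fin (n + 1), Ψ (-onShell m (p j)) n (fun i => p (j.succAbove i))

/-- The field products `∫ dx_1 ⋯ dx_n φ(x_1) ⋯ φ(x_n) F(x_1, …, x_n)` for vector-valued `F` with
inverse Fourier transform `Ψ`, where `φ(x) = ∫ dμ(k) (a(k) e^{-ikx} + a*(k) e^{ikx})`; the
rightmost field acts first. -/
def smear (m : ℝ) : (n : ℕ) → ((Fin n → R4) → FockFn) → FockFn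
  | 0, Ψ => Ψ Fin.elim0
  | n + 1, Ψ => smear m n fun k =>
      ((2 * Real.pi : ℝ) : ℂ) ^ 4 •
        (annih m (fun l => Ψ (Fin.snoc k l)) + create m (fun l => Ψ (Fin.snoc k l)))

/-- The operator `φ^{⊗|B|}(F)` of the free field of mass `m`, for a test function `F` of the
variables `x_B` with inverse Fourier transform `g`. -/
def phiTensor (m : ℝ) (B : Type*) [LinearOrder B] [Fintype B] (g : (B → R4) → ℂ) : FockOp :=
  fun ψ => smear m (Fintype.card B) fun k n p => g (fun b => k ((enum B).symm b)) * ψ.comp n p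

/-- The ordinary Wick product `:φ^{⊗|B|}:(F)` on Minkowski space, as alternating sum over all
contractions. -/
def wickTensor (m : ℝ) (B : Type*) [LinearOrder B] [Fintype B] (g : (B → R4) → ℂ) : FockOp :=
  ∑ C : Contraction B, (-1 : ℂ) ^ C.A.card • phiTensor m C.U (C.gamma0 m g)

/-! ### Fields on quantum spacetime -/

namespace QState

variable {lam : ℝ}

/-- `ω_σ(∏_{b ∈ B} e^{-i k_b q})`, the product being taken in the order of `B`. -/
def weylCorr (ω : QState lam) (σ : QSpec lam) {B : Type*} [LinearOrder B] [Fintype B]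
    (k : B → R4) : ℂ :=
  evalWeyl (ω.χ σ) (List.ofFn fun j => expq σ.1 (-(k (enum B j)))).prod

/-- The inverse Fourier transform of `ψ_ω^{(|B|)} × g` for a function `g` with values in
the centre, that is
`∫ dμ(σ) (2π)^{4|B|} ψ̌_{ω,σ}^{(|B|)}(k_B) ǧ_σ(k_B)`, where
`ψ̌_ω^{(|B|)}(k_B) = (2π)^{-4|B|} ω(∏ e^{-i k_b q})`. -/
def wignerConv (ω : QState lam) {B : Type*} [LinearOrder B] [Fintype B]
    (g : QSpec lam → (B → R4) → ℂ) (k : B → R4) : ℂ :=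
  ∫ σ, ω.weylCorr σ k * g σ k ∂ω.μ

/-- The regularized product of fields `φ^{|B|}_g` on quantum spacetime, in the state `ω`. -/
def phi (ω : QState lam) (m : ℝ) (B : Type*) [LinearOrder B] [Fintype B]
    (g : QSpec lam → (B → R4) → ℂ) : FockOp :=
  phiTensor m B (ω.wignerConv g)

/-- The ordinary Wick product `:φ^{|B|}_g:` on quantum spacetime, in the state `ω`. -/
def wick (ω : QState lam) (m : ℝ) (B : Type*) [LinearOrder B] [Fintype B]
    (g : QSpec lam → (B → R4) → ℂ) : FockOp :=
  wickTensor m B (ω.wignerConv g)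

open scoped Classical in
/-- The quasiplanar Wick product `:φ^{|N|}_f:_qp`, in the state `ω`. -/
def qpWick (ω : QState lam) (m : ℝ) {N : Type*} [LinearOrder N] [Fintype N]
    (f : SchwartzMap (N → R4) ℂ) : FockOp :=
  ∑ C : Contraction N with C.MemQP,
    (-1 : ℂ) ^ C.kappa • ω.phi m C.U (fun σ => C.gamma m (invFourier f) σ.1)

end QState

end NCWick

end

/-!
In a fixed state, the Weyl operators can be absorbed into the test function. If the two ends of each
line of a contraction `C` carry opposite momenta, then the Weyl operators of a line can be commuted
next to each other and cancel; the phases that arise come from the crossing lines and from the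
uncontracted indices inside a line, and are exactly those of the quantum contraction
(`Contraction.weylCorr_mul_exp_phase`). With `H(k_N) = ∫ dμ(σ) ω_σ(∏ e^{-i k_n q}) f̌(k_N)`, the
function entering the field product of `γ^C f` is therefore the ordinary contraction `γ_0^C H`
(`wignerConv_gamma`). The interchange of integrals is justified by the bound `|H| ≤ |f̌|`, a
consequence of positivity of the state, and by the decay of `f̌`, which is a Schwartz function.

Ordinary contraction maps compose: contracting along `C` and then along a contraction `D` of the
remaining indices is contracting along the union of the two (`Contraction.gamma0_gamma0`). Both
sides of the theorem are thus signed sums over contractions `Y` of the same operators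
`φ^{⊗|U|}(γ_0^Y H)`, and the coefficients remain to be compared
(`Contraction.sum_memQP_eq_sum_join`). On the right, the coefficient of `Y` is the sum of
`(-1)^{|Y ∖ C|}` over the aplanar contractions `C ⊆ Y`. By Möbius inversion on the subsets of the
lines of `Y`, it is `(-1)^κ` on `C_qp(N)` and zero elsewhere as soon as
`∑_{R ⊆ C, R ∈ C_qp(N)} (-1)^{κ(R)}` is one for aplanar `C` and zero otherwise
(`Contraction.sum_memQP_restr`).

Now the `R ∈ C_qp(N)` contained in `C` are the unions of quasiplanar components of `C`: a line that
crosses a line of a quasiplanar component has an endpoint inside that component, hence belongs to it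
(`Contraction.exists_supp_eq`). So the sum runs over all sets of quasiplanar components with sign
`(-1)^{cardinality}`, and vanishes unless there is none. Finally `C` has no quasiplanar component
exactly if it is aplanar (`Contraction.isAplanar_iff`): a component that encloses no uncontracted
index is quasiplanar or has another such component nested in it.
-/

noncomputable section

namespace NCWick

/-! ### Contractions as matchings -/

namespace Contraction

variable {N : Type*} [LinearOrder N] [Fintype N]

/-- `C.Line a b`: the pair `(a, b)` is an internal line of `C`, that is `a ∈ A` and `α a = b`. -/
def Line (C : Contraction N) (a b : N) : Prop := ∃ h : a ∈ C.A, C.α ⟨a, h⟩ = b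

theorem line_α (C : Contraction N) (a : C.A) : C.Line a (C.α a) := ⟨a.2, rfl⟩

theorem Line.mem {C : Contraction N} {a b : N} (h : C.Line a b) : a ∈ C.A := h.1

theorem Line.α_eq {C : Contraction N} {a b : N} (h : C.Line a b) (ha : a ∈ C.A) :
    C.α ⟨a, ha⟩ = b := h.2

theorem mem_A_iff {C : Contraction N} {a : N} : a ∈ C.A ↔ ∃ b, C.Line a b :=
  ⟨fun h => ⟨_, h, rfl⟩, fun ⟨_, h⟩ => h.1⟩

theorem Line.lt {C : Contraction N} {a b : N} (h : C.Line a b) : a < b := by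
  obtain ⟨h, rfl⟩ := h
  exact C.lt ⟨a, h⟩

theorem Line.right_unique {C : Contraction N} {a b b' : N} (h : C.Line a b) (h' : C.Line a b') :
    b = b' := by
  obtain ⟨h, rfl⟩ := h
  obtain ⟨h', rfl⟩ := h'
  rfl

theorem Line.left_unique {C : Contraction N} {a a' b : N} (h : C.Line a b) (h' : C.Line a' b) :
    a = a' := by
  obtain ⟨h, rfl⟩ := h
  obtain ⟨h', e⟩ := h'
  exact congrArg Subtype.val (C.injective e.symm)

theorem Line.not_line {C : Contraction N} {a b c : N} (h : C.Line a b) : ¬ C.Line b c := by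
  obtain ⟨h, rfl⟩ := h
  exact fun h' => C.notMem _ h'.1

theorem mem_U_iff {C : Contraction N} {n : N} :
    n ∈ C.U ↔ ∀ b, ¬ C.Line n b ∧ ¬ C.Line b n := by
  simp only [U, Finset.mem_compl, Finset.mem_union, Finset.mem_image, Finset.mem_univ, true_and,
    mem_A_iff]
  constructor
  · exact fun h b => ⟨fun hb => h (Or.inl ⟨b, hb⟩), fun hb => h (Or.inr ⟨⟨b, hb.1⟩, hb.2⟩)⟩
  · rintro h (⟨b, hb⟩ | ⟨b, hb⟩)
    · exact (h b).1 hb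
    · exact (h b).2 ⟨b.2, hb⟩

theorem not_mem_U {C : Contraction N} {n : N} (h : n ∉ C.U) :
    ∃ b, C.Line n b ∨ C.Line b n := by
  rw [mem_U_iff] at h
  push Not at h
  obtain ⟨b, hb⟩ := h
  exact ⟨b, by tauto⟩

theorem ext_line {C D : Contraction N} (h : ∀ a b, C.Line a b ↔ D.Line a b) : C = D := by
  obtain ⟨A, α, i1, i2, i3⟩ := C
  obtain ⟨A', α', j1, j2, j3⟩ := D
  obtain rfl : A = A' := by
    ext a
    constructor
    · exact fun ha => ((h a _).1 ⟨ha, rfl⟩).1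
    · exact fun ha => ((h a _).2 ⟨ha, rfl⟩).1
  obtain rfl : α = α' := by
    funext a
    exact (((h a _).1 ⟨a.2, rfl⟩).2).symm
  rfl

/-- Two endpoints of lines of a contraction coincide only if the lines do. -/
theorem Line.eq_of_endpoint {C : Contraction N} {a b a' b' x : N} (h : C.Line a b)
    (h' : C.Line a' b') (hx : x = a ∨ x = b) (hx' : x = a' ∨ x = b') : a = a' := by
  rcases hx with rfl | rfl <;> rcases hx' with rfl | rfl
  · rfl
  · exact absurd h h'.not_line
  · exact absurd h' h.not_line
  · exact h.left_unique h'

/-- The relations on `N` that are the line relation of a contraction. -/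
structure IsMatching (R : N → N → Prop) : Prop where
  lt : ∀ {a b}, R a b → a < b
  right_unique : ∀ {a b b'}, R a b → R a b' → b = b'
  left_unique : ∀ {a a' b}, R a b → R a' b → a = a'
  not_rel : ∀ {a b c}, R a b → ¬ R b c

open scoped Classical in
/-- The contraction with a given line relation. -/
def ofRel (R : N → N → Prop) (h : IsMatching R) : Contraction N where
  A := Finset.univ.filter fun a => ∃ b, R a b
  α a := ((Finset.mem_filter.mp a.2).2).choose
  injective a a' e := by
    have h1 := ((Finset.mem_filter.mp a.2).2).choose_spec
    have h2 := ((Finset.mem_filter.mp a'.2).2).choose_spec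
    simp only at e
    rw [← e] at h2
    exact Subtype.ext (h.left_unique h1 h2)
  notMem a hm := by
    obtain ⟨c, hc⟩ := (Finset.mem_filter.mp hm).2
    exact h.not_rel ((Finset.mem_filter.mp a.2).2).choose_spec hc
  lt a := h.lt ((Finset.mem_filter.mp a.2).2).choose_spec

theorem ofRel_line {R : N → N → Prop} (h : IsMatching R) {a b : N} :
    (ofRel R h).Line a b ↔ R a b := by
  classical
  constructor
  · rintro ⟨ha, rfl⟩
    exact ((Finset.mem_filter.mp ha).2).choose_spec
  · intro hab
    have ha : a ∈ (ofRel R h).A := Finset.mem_filter.mpr ⟨Finset.mem_univ _, b, hab⟩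
    exact ⟨ha, h.right_unique ((Finset.mem_filter.mp ha).2).choose_spec hab⟩

/-- The contraction formed by the lines of `C` that start in `S`. -/
def restr (C : Contraction N) (S : Finset N) : Contraction N :=
  ofRel (fun a b => C.Line a b ∧ a ∈ S)
    ⟨fun h => h.1.lt, fun h h' => h.1.right_unique h'.1, fun h h' => h.1.left_unique h'.1,
      fun h h' => h.1.not_line h'.1⟩

theorem restr_line {C : Contraction N} {S : Finset N} {a b : N} :
    (C.restr S).Line a b ↔ C.Line a b ∧ a ∈ S := ofRel_line _

theorem mem_restr_A {C : Contraction N} {S : Finset N} {a : N} :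
    a ∈ (C.restr S).A ↔ a ∈ C.A ∧ a ∈ S := by
  simp only [mem_A_iff, restr_line, exists_and_right]

theorem restr_A {C : Contraction N} {S : Finset N} (hS : S ⊆ C.A) : (C.restr S).A = S := by
  ext a
  rw [mem_restr_A]
  exact ⟨fun h => h.2, fun h => ⟨hS h, h⟩⟩

theorem restr_restr {C : Contraction N} {S R : Finset N} (h : R ⊆ S) :
    (C.restr S).restr R = C.restr R :=
  ext_line fun a b => by
    simp only [restr_line]
    exact ⟨fun h => ⟨h.1.1, h.2⟩, fun h' => ⟨⟨h'.1, h h'.2⟩, h'.2⟩⟩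

theorem restr_self (C : Contraction N) : C.restr C.A = C :=
  ext_line fun a b => by
    rw [restr_line]
    exact ⟨fun h => h.1, fun h => ⟨h, h.mem⟩⟩

/-- The lines of `C` whose endpoints are both uncontracted in `C'`, as a contraction of the
uncontracted indices of `C'`. -/
def rest (C C' : Contraction N) : Contraction C'.U :=
  ofRel (fun u v => C.Line u v)
    ⟨fun h => h.lt, fun h h' => Subtype.ext (h.right_unique h'),
      fun h h' => Subtype.ext (h.left_unique h'), fun h h' => h.not_line h'⟩

theorem rest_line {C C' : Contraction N} {u v : C'.U} :
    (C.rest C').Line u v ↔ C.Line u v := ofRel_line _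

theorem not_line_of_mem_U {C : Contraction N} {u b : N} (hu : u ∈ C.U) : ¬ C.Line u b :=
  (mem_U_iff.1 hu b).1

theorem not_line_of_mem_U' {C : Contraction N} {u b : N} (hu : u ∈ C.U) : ¬ C.Line b u :=
  (mem_U_iff.1 hu b).2

/-- The contraction in `N` formed by the lines of `C` and those of a contraction `D` of the indices
left uncontracted by `C`. -/
def join (C : Contraction N) (D : Contraction C.U) : Contraction N :=
  ofRel (fun a b => C.Line a b ∨ ∃ u v : C.U, (u : N) = a ∧ (v : N) = b ∧ D.Line u v) {
    lt := by
      rintro _ _ (h | ⟨u, v, rfl, rfl, h⟩)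
      exacts [h.lt, h.lt]
    right_unique := by
      rintro _ _ _ (h | ⟨u, v, rfl, rfl, h⟩) (h' | ⟨u', v', e, rfl, h'⟩)
      · exact h.right_unique h'
      · exact absurd h (e ▸ not_line_of_mem_U u'.2)
      · exact absurd h' (not_line_of_mem_U u.2)
      · obtain rfl := Subtype.ext e
        exact congrArg Subtype.val (h.right_unique h')
    left_unique := by
      rintro _ _ _ (h | ⟨u, v, rfl, rfl, h⟩) (h' | ⟨u', v', rfl, e, h'⟩)
      · exact h.left_unique h'
      · exact absurd h (e ▸ not_line_of_mem_U' v'.2)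
      · exact absurd h' (not_line_of_mem_U' v.2)
      · obtain rfl := Subtype.ext e
        exact congrArg Subtype.val (h.left_unique h')
    not_rel := by
      rintro _ _ _ (h | ⟨u, v, rfl, rfl, h⟩) (h' | ⟨u', v', e, rfl, h'⟩)
      · exact h.not_line h'
      · exact absurd h (e ▸ not_line_of_mem_U' u'.2)
      · exact absurd h' (not_line_of_mem_U v.2)
      · obtain rfl := Subtype.ext e
        exact h.not_line h' }

theorem join_line {C : Contraction N} {D : Contraction C.U} {a b : N} :
    (C.join D).Line a b ↔
      C.Line a b ∨ ∃ u v : C.U, (u : N) = a ∧ (v : N) = b ∧ D.Line u v := ofRel_line _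

theorem join_line_coe {C : Contraction N} {D : Contraction C.U} {u v : C.U} :
    (C.join D).Line u v ↔ D.Line u v := by
  rw [join_line]
  constructor
  · rintro (h | ⟨u', v', e, e', h⟩)
    · exact absurd h (not_line_of_mem_U u.2)
    · rwa [← Subtype.ext e, ← Subtype.ext e']
  · exact fun h => Or.inr ⟨u, v, rfl, rfl, h⟩

theorem rest_join (C : Contraction N) (D : Contraction C.U) : (C.join D).rest C = D :=
  ext_line fun _ _ => by rw [rest_line, join_line_coe]

theorem restr_join (C : Contraction N) (D : Contraction C.U) : (C.join D).restr C.A = C :=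
  ext_line fun a b => by
    rw [restr_line, join_line]
    constructor
    · rintro ⟨h | ⟨u, v, rfl, rfl, h⟩, ha⟩
      · exact h
      · obtain ⟨c, hc⟩ := mem_A_iff.1 ha
        exact absurd hc (not_line_of_mem_U u.2)
    · exact fun h => ⟨Or.inl h, h.mem⟩

theorem join_restr_rest (Y : Contraction N) (S : Finset N) :
    (Y.restr S).join (Y.rest (Y.restr S)) = Y :=
  ext_line fun a b => by
    rw [join_line, restr_line]
    constructor
    · rintro (h | ⟨u, v, rfl, rfl, h⟩)
      · exact h.1
      · exact rest_line.1 h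
    · intro h
      by_cases ha : a ∈ S
      · exact Or.inl ⟨h, ha⟩
      · refine Or.inr ⟨⟨a, mem_U_iff.2 fun c => ?_⟩, ⟨b, mem_U_iff.2 fun c => ?_⟩, rfl, rfl,
          rest_line.2 h⟩
        · simp only [restr_line]
          exact ⟨fun h' => ha h'.2, fun h' => h'.1.not_line h⟩
        · simp only [restr_line]
          exact ⟨fun h' => h.not_line h'.1, fun h' => ha (h.left_unique h'.1 ▸ h'.2)⟩

theorem mem_join_A {C : Contraction N} {D : Contraction C.U} {a : N} :
    a ∈ (C.join D).A ↔ a ∈ C.A ∨ ∃ u ∈ D.A, (u : N) = a := by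
  simp only [mem_A_iff, join_line]
  constructor
  · rintro ⟨b, h | ⟨u, v, rfl, rfl, h⟩⟩
    exacts [Or.inl ⟨b, h⟩, Or.inr ⟨u, ⟨v, h⟩, rfl⟩]
  · rintro (⟨b, h⟩ | ⟨u, ⟨v, h⟩, rfl⟩)
    exacts [⟨b, Or.inl h⟩, ⟨v, Or.inr ⟨u, v, rfl, rfl, h⟩⟩]

theorem mem_join_U {C : Contraction N} {D : Contraction C.U} {n : N} :
    n ∈ (C.join D).U ↔ ∃ u ∈ D.U, (u : N) = n := by
  constructor
  · intro h
    have hC : n ∈ C.U := mem_U_iff.2 fun b =>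
      ⟨fun hb => not_line_of_mem_U h (join_line.2 (Or.inl hb)),
        fun hb => not_line_of_mem_U' h (join_line.2 (Or.inl hb))⟩
    refine ⟨⟨n, hC⟩, mem_U_iff.2 fun b => ⟨fun hb => ?_, fun hb => ?_⟩, rfl⟩
    · exact not_line_of_mem_U h (join_line_coe.2 hb)
    · exact not_line_of_mem_U' h (join_line_coe.2 hb)
  · rintro ⟨u, hu, rfl⟩
    refine mem_U_iff.2 fun b => ⟨fun hb => ?_, fun hb => ?_⟩
    · rcases join_line.1 hb with h | ⟨u', v, e, -, h⟩
      · exact not_line_of_mem_U u.2 h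
      · exact not_line_of_mem_U hu (Subtype.ext e ▸ h)
    · rcases join_line.1 hb with h | ⟨u', v, -, e, h⟩
      · exact not_line_of_mem_U' u.2 h
      · exact not_line_of_mem_U' hu (Subtype.ext e ▸ h)

theorem card_join_A_sdiff (C : Contraction N) (D : Contraction C.U) :
    ((C.join D).A \ C.A).card = D.A.card := by
  rw [← Finset.card_map (Function.Embedding.subtype (· ∈ C.U))]
  congr 1
  ext a
  simp only [Finset.mem_sdiff, mem_join_A, Finset.mem_map, Function.Embedding.subtype_apply]
  constructor
  · rintro ⟨h | h, ha⟩
    exacts [absurd h ha, h]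
  · rintro ⟨u, hu, rfl⟩
    refine ⟨Or.inr ⟨u, hu, rfl⟩, fun h => ?_⟩
    obtain ⟨b, hb⟩ := mem_A_iff.1 h
    exact not_line_of_mem_U u.2 hb

/-! ### Connected components and quasiplanarity -/

theorem lineGraph_adj {C : Contraction N} {a a' : C.A} :
    C.lineGraph.Adj a a' ↔ C.Intersects a a' ∨ C.Intersects a' a := by
  rw [lineGraph, SimpleGraph.fromRel_adj]
  refine ⟨fun h => h.2, fun h => ⟨?_, h⟩⟩
  rintro rfl
  rcases h with h | h <;> exact lt_irrefl _ h.1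

theorem component_line {C : Contraction N} {K : C.Component} {a b : N} :
    (C.component K).Line a b ↔
      C.Line a b ∧ ∃ h : a ∈ C.A, C.lineGraph.connectedComponentMk ⟨a, h⟩ = K := by
  classical
  constructor
  · rintro ⟨h, rfl⟩
    exact ⟨⟨(Finset.mem_filter.mp h).1, rfl⟩, (Finset.mem_filter.mp h).2⟩
  · rintro ⟨⟨h, rfl⟩, hK⟩
    exact ⟨Finset.mem_filter.mpr ⟨h, hK⟩, rfl⟩

theorem isQuasiplanar_iff {C : Contraction N} :
    C.IsQuasiplanar ↔ ∀ a b u, C.Line a b → u ∈ C.U → ¬ (a < u ∧ u < b) := by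
  constructor
  · rintro h a b u ⟨ha, rfl⟩ hu
    exact h ⟨a, ha⟩ ⟨u, hu⟩
  · exact fun h a u => h a _ u (C.line_α a) u.2

/-- If a line of another component has an endpoint inside the line `a`, then it lies entirely
inside of it: otherwise the two lines would intersect. -/
theorem nested_of_endpoint {C : Contraction N} {a b : C.A}
    (hab : ¬ C.lineGraph.Reachable a b) {x : N} (hx : x = b ∨ x = C.α b)
    (h1 : (a : N) < x) (h2 : x < C.α a) : (a : N) < b ∧ C.α b < C.α a := by
  have hne : a ≠ b := by
    rintro rfl
    exact hab (SimpleGraph.Reachable.refl a)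
  have hadj : ¬ (C.Intersects a b ∨ C.Intersects b a) := fun h =>
    hab (lineGraph_adj.2 h).reachable
  push Not at hadj
  have hb := C.lt b
  rcases hx with rfl | rfl
  · refine ⟨h1, lt_of_le_of_ne (not_lt.1 fun h => hadj.1 ⟨h1, h2, h⟩) fun h => hne ?_⟩
    exact (C.injective h).symm
  · refine ⟨lt_of_le_of_ne (not_lt.1 fun h => hadj.2 ⟨h, h1, h2⟩) fun h => hne ?_, h2⟩
    exact Subtype.ext h

/-- A component with one endpoint inside a line of another component lies entirely inside that
line. -/
theorem nested_of_reachable {C : Contraction N} {a b c : C.A}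
    (hab : ¬ C.lineGraph.Reachable a b) {x : N} (hx : x = b ∨ x = C.α b)
    (h1 : (a : N) < x) (h2 : x < C.α a) (hbc : C.lineGraph.Reachable b c) :
    (a : N) < c ∧ C.α c < C.α a := by
  rw [SimpleGraph.reachable_iff_reflTransGen] at hbc
  induction hbc with
  | refl => exact nested_of_endpoint hab hx h1 h2
  | @tail c d hbc hcd ih =>
    have had : ¬ C.lineGraph.Reachable a d := fun h => hab
      ((h.trans hcd.symm.reachable).trans
        ((SimpleGraph.reachable_iff_reflTransGen _ _).2 hbc).symm)
    have hc := C.lt c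
    rcases lineGraph_adj.1 hcd with h | h
    · exact nested_of_endpoint had (Or.inl rfl) (ih.1.trans h.1) (h.2.1.trans ih.2)
    · exact nested_of_endpoint had (Or.inr rfl) (ih.1.trans h.2.1) (h.2.2.trans ih.2)

/-- A component that encloses no uncontracted index is quasiplanar, or one of its lines contains
another component, which again encloses no uncontracted index; descending in this way one finally
meets a quasiplanar component. -/
theorem exists_isQuasiplanar_component {C : Contraction N} (K : C.Component)
    (hK : ∀ a : C.A, C.lineGraph.connectedComponentMk a = K → ∀ u : C.U, ¬ C.Encloses a u) :
    ∃ K' : C.Component, (C.component K').IsQuasiplanar := by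
  classical
  -- The up-set of the left endpoints shrinks from a component to any component nested in it.
  induction hn : (Finset.univ.filter fun n : N =>
      ∃ c : C.A, C.lineGraph.connectedComponentMk c = K ∧ (c : N) ≤ n).card
    using Nat.strong_induction_on generalizing K with
  | _ n ih =>
  by_contra hno
  have hq : ¬ (C.component K).IsQuasiplanar := fun h => hno ⟨K, h⟩
  rw [isQuasiplanar_iff] at hq
  push Not at hq
  obtain ⟨a, _, x, hab, hx, h1, h2⟩ := hq
  obtain ⟨⟨ha, rfl⟩, _, haK⟩ := component_line.1 hab
  have hxU : x ∉ C.U := fun h => hK ⟨a, ha⟩ haK ⟨x, h⟩ ⟨h1, h2⟩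
  obtain ⟨b, hxb⟩ : ∃ b : C.A, x = b ∨ x = C.α b := by
    obtain ⟨b, h | h⟩ := not_mem_U hxU
    · exact ⟨⟨x, h.mem⟩, Or.inl rfl⟩
    · exact ⟨⟨b, h.mem⟩, Or.inr h.2.symm⟩
  have hr : ¬ C.lineGraph.Reachable ⟨a, ha⟩ b := by
    intro hr
    have hbK : C.lineGraph.connectedComponentMk b = K :=
      (SimpleGraph.ConnectedComponent.eq.2 hr.symm).trans haK
    have hl : (C.component K).Line b (C.α b) :=
      component_line.2 ⟨C.line_α b, b.2, hbK⟩
    rcases hxb with rfl | rfl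
    · exact not_line_of_mem_U hx hl
    · exact not_line_of_mem_U' hx hl
  have key : ∀ c : C.A, C.lineGraph.connectedComponentMk c = C.lineGraph.connectedComponentMk b →
      a < c ∧ C.α c < C.α ⟨a, ha⟩ := fun c hc =>
    nested_of_reachable hr hxb h1 h2 (SimpleGraph.ConnectedComponent.eq.1 hc).symm
  refine hno (ih _ ?_ (C.lineGraph.connectedComponentMk b) ?_ rfl)
  · rw [← hn]
    refine Finset.card_lt_card (Finset.ssubset_iff_of_subset ?_ |>.2 ⟨a, ?_, ?_⟩)
    · intro n hn
      obtain ⟨c, hc, hcn⟩ := (Finset.mem_filter.1 hn).2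
      exact Finset.mem_filter.2 ⟨Finset.mem_univ _, ⟨a, ha⟩, haK, (key c hc).1.le.trans hcn⟩
    · exact Finset.mem_filter.2 ⟨Finset.mem_univ _, ⟨a, ha⟩, haK, le_rfl⟩
    · intro hn
      obtain ⟨c, hc, hcn⟩ := (Finset.mem_filter.1 hn).2
      exact absurd (key c hc).1 (not_lt.2 hcn)
  · intro c hc u hu
    exact hK ⟨a, ha⟩ haK u ⟨(key c hc).1.trans hu.1, hu.2.trans (key c hc).2⟩

theorem isAplanar_iff {C : Contraction N} :
    C.IsAplanar ↔ ∀ K : C.Component, ¬ (C.component K).IsQuasiplanar := by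
  constructor
  · intro h K hK
    obtain ⟨a, ha, u, hu⟩ := h K
    refine isQuasiplanar_iff.1 hK a _ u (component_line.2 ⟨C.line_α a, a.2, ha⟩) ?_ hu
    refine mem_U_iff.2 fun b => ⟨fun hb => ?_, fun hb => ?_⟩
    · exact not_line_of_mem_U u.2 (component_line.1 hb).1
    · exact not_line_of_mem_U' u.2 (component_line.1 hb).1
  · intro h K
    by_contra hK
    push Not at hK
    obtain ⟨K', hK'⟩ := exists_isQuasiplanar_component K hK
    exact h K' hK'

/-- The inclusion of the lines of a restriction. -/
def restrIncl (C : Contraction N) (S : Finset N) (x : (C.restr S).A) : C.A :=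
  ⟨x, (mem_restr_A.1 x.2).1⟩

theorem restr_α {C : Contraction N} {S : Finset N} (x : (C.restr S).A) :
    (C.restr S).α x = C.α (C.restrIncl S x) :=
  ((restr_line.1 ((C.restr S).line_α x)).1.α_eq _).symm

theorem restr_adj {C : Contraction N} {S : Finset N} {x y : (C.restr S).A} :
    (C.restr S).lineGraph.Adj x y ↔ C.lineGraph.Adj (C.restrIncl S x) (C.restrIncl S y) := by
  simp only [lineGraph_adj, Intersects, restr_α]
  rfl

theorem reachable_of_restr {C : Contraction N} {S : Finset N} {x y : (C.restr S).A}
    (h : (C.restr S).lineGraph.Reachable x y) :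
    C.lineGraph.Reachable (C.restrIncl S x) (C.restrIncl S y) :=
  h.map ⟨C.restrIncl S, fun h => restr_adj.1 h⟩

/-- The left endpoints in a set of components. -/
def supp (C : Contraction N) (T : Finset C.Component) : Finset N :=
  open scoped Classical in
  Finset.univ.filter fun n => ∃ h : n ∈ C.A, C.lineGraph.connectedComponentMk ⟨n, h⟩ ∈ T

theorem mem_supp {C : Contraction N} {T : Finset C.Component} {n : N} :
    n ∈ C.supp T ↔ ∃ h : n ∈ C.A, C.lineGraph.connectedComponentMk ⟨n, h⟩ ∈ T := by
  classical
  simp [supp]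

theorem supp_subset (C : Contraction N) (T : Finset C.Component) : C.supp T ⊆ C.A :=
  fun _ h => (mem_supp.1 h).1

theorem restr_supp_reachable {C : Contraction N} {T : Finset C.Component}
    {x y : (C.restr (C.supp T)).A} :
    (C.restr (C.supp T)).lineGraph.Reachable x y ↔
      C.lineGraph.Reachable (C.restrIncl _ x) (C.restrIncl _ y) := by
  refine ⟨reachable_of_restr, fun h => ?_⟩
  suffices H : ∀ z : C.A, C.lineGraph.Reachable (C.restrIncl _ x) z →
      ∃ hz : (z : N) ∈ (C.restr (C.supp T)).A,
        (C.restr (C.supp T)).lineGraph.Reachable x ⟨z, hz⟩ from (H _ h).2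
  intro z hz
  have hx := (mem_restr_A.1 x.2).2
  rw [SimpleGraph.reachable_iff_reflTransGen] at hz
  induction hz with
  | refl => exact ⟨x.2, SimpleGraph.Reachable.refl _⟩
  | @tail c d hbc hcd ih =>
    obtain ⟨hc, hxc⟩ := ih
    obtain ⟨hcA, hcT⟩ := mem_supp.1 (mem_restr_A.1 hc).2
    have hd : (d : N) ∈ (C.restr (C.supp T)).A := by
      refine mem_restr_A.2 ⟨d.2, mem_supp.2 ⟨d.2, ?_⟩⟩
      rwa [← SimpleGraph.ConnectedComponent.connectedComponentMk_eq_of_adj hcd]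
    exact ⟨hd, hxc.trans (SimpleGraph.Adj.reachable (restr_adj.2 hcd))⟩

theorem component_restr_supp {C : Contraction N} {T : Finset C.Component}
    (x : (C.restr (C.supp T)).A) :
    (C.restr (C.supp T)).component ((C.restr (C.supp T)).lineGraph.connectedComponentMk x) =
      C.component (C.lineGraph.connectedComponentMk (C.restrIncl _ x)) := by
  obtain ⟨hxA, hxT⟩ := mem_supp.1 (mem_restr_A.1 x.2).2
  refine ext_line fun a b => ?_
  simp only [component_line, restr_line, SimpleGraph.ConnectedComponent.eq]
  constructor
  · rintro ⟨h, ha, hr⟩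
    exact ⟨h.1, h.1.mem, restr_supp_reachable.1 hr⟩
  · rintro ⟨h, ha, hr⟩
    have haT : a ∈ C.supp T := by
      refine mem_supp.2 ⟨ha, ?_⟩
      rwa [SimpleGraph.ConnectedComponent.eq.2 hr]
    exact ⟨⟨h, haT⟩, mem_restr_A.2 ⟨ha, haT⟩, restr_supp_reachable.2 hr⟩

theorem exists_mem_component {C : Contraction N} (K : C.Component) :
    ∃ a : C.A, C.lineGraph.connectedComponentMk a = K :=
  SimpleGraph.ConnectedComponent.ind (fun a => ⟨a, rfl⟩) K

theorem memQP_restr_supp {C : Contraction N} {T : Finset C.Component} :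
    (C.restr (C.supp T)).MemQP ↔ ∀ K ∈ T, (C.component K).IsQuasiplanar := by
  constructor
  · intro h K hK
    obtain ⟨a, rfl⟩ := exists_mem_component K
    have ha : (a : N) ∈ (C.restr (C.supp T)).A :=
      mem_restr_A.2 ⟨a.2, mem_supp.2 ⟨a.2, hK⟩⟩
    have := h ((C.restr (C.supp T)).lineGraph.connectedComponentMk ⟨a, ha⟩)
    rwa [component_restr_supp] at this
  · intro h K
    obtain ⟨x, rfl⟩ := exists_mem_component K
    rw [component_restr_supp]
    exact h _ (mem_supp.1 (mem_restr_A.1 x.2).2).2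

theorem kappa_restr_supp (C : Contraction N) (T : Finset C.Component) :
    (C.restr (C.supp T)).kappa = T.card := by
  rw [kappa, ← Fintype.card_coe T, ← Nat.card_eq_fintype_card]
  refine Nat.card_congr (Equiv.ofBijective
    (SimpleGraph.ConnectedComponent.lift
      (fun x => (⟨C.lineGraph.connectedComponentMk (C.restrIncl _ x),
        (mem_supp.1 (mem_restr_A.1 x.2).2).2⟩ : {K // K ∈ T})) ?_) ⟨?_, ?_⟩)
  · intro x y p _
    exact Subtype.ext (SimpleGraph.ConnectedComponent.eq.2 (reachable_of_restr p.reachable))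
  · intro K K' h
    obtain ⟨x, rfl⟩ := exists_mem_component K
    obtain ⟨y, rfl⟩ := exists_mem_component K'
    have h' := congrArg Subtype.val h
    simp only [SimpleGraph.ConnectedComponent.lift_mk] at h'
    exact SimpleGraph.ConnectedComponent.eq.2
      (restr_supp_reachable.2 (SimpleGraph.ConnectedComponent.eq.1 h'))
  · rintro ⟨K, hK⟩
    obtain ⟨a, rfl⟩ := exists_mem_component K
    exact ⟨(C.restr (C.supp T)).lineGraph.connectedComponentMk
      ⟨a, mem_restr_A.2 ⟨a.2, mem_supp.2 ⟨a.2, hK⟩⟩⟩, rfl⟩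

/-- A line of `C` that intersects a line of a member `C.restr S` of `C_qp(N)` belongs to `C.restr S`:
one of its endpoints is enclosed, hence is an endpoint of a line of the same component. -/
theorem mem_of_adj_of_memQP {C : Contraction N} {S : Finset N} (hS : (C.restr S).MemQP)
    {a b : C.A} (ha : (a : N) ∈ S) (hab : C.lineGraph.Adj a b) : (b : N) ∈ S := by
  have ha' : (a : N) ∈ (C.restr S).A := mem_restr_A.2 ⟨a.2, ha⟩
  have hq := isQuasiplanar_iff.1
    (hS ((C.restr S).lineGraph.connectedComponentMk ⟨a, ha'⟩)) a (C.α a)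
  have hl : (C.restr S).Line a (C.α a) := restr_line.2 ⟨C.line_α a, ha⟩
  have key : ∀ x : N, (x = b ∨ x = C.α b) → (a : N) < x → x < C.α a → (b : N) ∈ S := by
    intro x hx h1 h2
    have hxU := fun h => hq x (component_line.2 ⟨hl, ha', rfl⟩) h ⟨h1, h2⟩
    obtain ⟨c, hc⟩ := not_mem_U hxU
    rcases hc with hc | hc
    · have hc' := restr_line.1 (component_line.1 hc).1
      have := (C.line_α b).eq_of_endpoint hc'.1 hx (Or.inl rfl)
      exact this ▸ hc'.2
    · have hc' := restr_line.1 (component_line.1 hc).1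
      have := (C.line_α b).eq_of_endpoint hc'.1 hx (Or.inr rfl)
      exact this ▸ hc'.2
  rcases lineGraph_adj.1 hab with h | h
  · exact key _ (Or.inl rfl) h.1 h.2.1
  · exact key _ (Or.inr rfl) h.2.1 h.2.2

/-- The members of `C_qp(N)` contained in `C` are the unions of components of `C`. -/
theorem exists_supp_eq {C : Contraction N} {S : Finset N} (hSA : S ⊆ C.A)
    (hS : (C.restr S).MemQP) : ∃ T : Finset C.Component, C.supp T = S := by
  classical
  refine ⟨S.attach.image fun a : {x // x ∈ S} => C.lineGraph.connectedComponentMk ⟨a, hSA a.2⟩, ?_⟩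
  ext n
  simp only [mem_supp, Finset.mem_image, Finset.mem_attach, true_and, Subtype.exists,
    SimpleGraph.ConnectedComponent.eq]
  constructor
  · rintro ⟨hn, a, ha, hr⟩
    rw [SimpleGraph.reachable_iff_reflTransGen] at hr
    generalize hz : (⟨n, hn⟩ : C.A) = z at hr
    suffices (z : N) ∈ S by rwa [← hz] at this
    clear hz
    induction hr with
    | refl => exact ha
    | tail _ h ih => exact mem_of_adj_of_memQP hS ih h
  · exact fun h => ⟨hSA h, n, h, SimpleGraph.Reachable.refl _⟩

theorem supp_injective (C : Contraction N) : Function.Injective C.supp := by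
  intro T T' h
  ext K
  obtain ⟨a, rfl⟩ := exists_mem_component K
  have h1 : ∀ T, (a : N) ∈ C.supp T ↔ C.lineGraph.connectedComponentMk a ∈ T := fun T =>
    mem_supp.trans ⟨fun h => h.2, fun h => ⟨a.2, h⟩⟩
  rw [← h1, ← h1, h]

/-! ### The inversion formula -/

open scoped Classical in
/-- The signed count of the members of `C_qp(N)` contained in `C`: these correspond to the sets of
quasiplanar components of `C`, so that the sum vanishes unless there is none. -/
theorem sum_memQP_restr (C : Contraction N) :
    ∑ R ∈ C.A.powerset with (C.restr R).MemQP, (-1 : ℤ) ^ (C.restr R).kappa =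
      if C.IsAplanar then 1 else 0 := by
  let _ : Fintype C.Component := Fintype.ofFinite _
  have h : ∑ T ∈ (Finset.univ.filter fun K : C.Component =>
      (C.component K).IsQuasiplanar).powerset, (-1 : ℤ) ^ T.card =
      ∑ R ∈ C.A.powerset with (C.restr R).MemQP, (-1 : ℤ) ^ (C.restr R).kappa := by
    refine Finset.sum_bij (fun T _ => C.supp T) ?_ ?_ ?_ ?_
    · intro T hT
      refine Finset.mem_filter.2 ⟨Finset.mem_powerset.2 (C.supp_subset T), ?_⟩
      exact memQP_restr_supp.2 fun K hK =>
        (Finset.mem_filter.1 (Finset.mem_powerset.1 hT hK)).2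
    · exact fun T _ T' _ h => C.supp_injective h
    · intro S hS
      obtain ⟨hSA, hQ⟩ := Finset.mem_filter.1 hS
      obtain ⟨T, rfl⟩ := exists_supp_eq (Finset.mem_powerset.1 hSA) hQ
      exact ⟨T, Finset.mem_powerset.2 fun K hK => Finset.mem_filter.2
        ⟨Finset.mem_univ _, memQP_restr_supp.1 hQ K hK⟩, rfl⟩
    · exact fun T _ => by rw [kappa_restr_supp]
  rw [← h, Finset.sum_powerset_neg_one_pow_card]
  refine if_congr ?_ rfl rfl
  rw [isAplanar_iff, Finset.filter_eq_empty_iff]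
  simp

end Contraction

/-- Möbius inversion on the subsets of a finite set. -/
theorem sum_powerset_neg_one_pow_sdiff {α : Type*} [DecidableEq α] (A : Finset α)
    (g : Finset α → ℤ) :
    ∑ S ∈ A.powerset, (-1 : ℤ) ^ (A \ S).card * ∑ R ∈ S.powerset, g R = g A := by
  simp only [Finset.mul_sum]
  rw [Finset.sum_comm' (s' := fun R => A.powerset.filter (R ⊆ ·)) (t' := A.powerset)]
  · rw [Finset.sum_eq_single_of_mem A (Finset.mem_powerset_self A)]
    · rw [Finset.sum_eq_single_of_mem A (by simp)]
      · simp
      · intro S hS hne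
        rw [Finset.mem_filter, Finset.mem_powerset] at hS
        exact absurd (Finset.Subset.antisymm hS.1 hS.2) hne
    · intro R hR hne
      -- The subsets between `R` and `A` are as often of even as of odd size.
      rw [← Finset.sum_mul]
      have : ∑ S ∈ A.powerset with R ⊆ S, (-1 : ℤ) ^ (A \ S).card =
          ∑ T ∈ (A \ R).powerset, (-1 : ℤ) ^ T.card := by
        refine Finset.sum_bij (fun S _ => A \ S) ?_ ?_ ?_ (fun _ _ => rfl)
        · intro S hS
          exact Finset.mem_powerset.2 (Finset.sdiff_subset_sdiff subset_rfl
            (Finset.mem_filter.1 hS).2)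
        · intro S hS S' hS' h
          simp only [Finset.mem_filter, Finset.mem_powerset] at hS hS'
          rw [← Finset.sdiff_sdiff_eq_self hS.1, h, Finset.sdiff_sdiff_eq_self hS'.1]
        · intro T hT
          rw [Finset.mem_powerset] at hT
          refine ⟨A \ T, ?_, ?_⟩
          · rw [Finset.mem_filter, Finset.mem_powerset]
            refine ⟨Finset.sdiff_subset, fun x hx => ?_⟩
            exact Finset.mem_sdiff.2 ⟨Finset.mem_powerset.1 hR hx,
              fun h => (Finset.mem_sdiff.1 (hT h)).2 hx⟩
          · exact Finset.sdiff_sdiff_eq_self (hT.trans Finset.sdiff_subset)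
      rw [this, Finset.sum_powerset_neg_one_pow_card, if_neg, zero_mul]
      rw [Finset.sdiff_eq_empty_iff_subset]
      exact fun h => hne (Finset.Subset.antisymm (Finset.mem_powerset.1 hR) h)
  · intro S R
    simp only [Finset.mem_filter, Finset.mem_powerset]
    exact ⟨fun h => ⟨h, h.2.trans h.1⟩, fun h => h.1⟩

namespace Contraction

variable {N : Type*} [LinearOrder N] [Fintype N]

open scoped Classical in
theorem sum_isAplanar_restr (Y : Contraction N) :
    ∑ S ∈ Y.A.powerset with (Y.restr S).IsAplanar, (-1 : ℤ) ^ (Y.A \ S).card =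
      if Y.MemQP then (-1) ^ Y.kappa else 0 := by
  have h := sum_powerset_neg_one_pow_sdiff Y.A
    fun R => if (Y.restr R).MemQP then (-1 : ℤ) ^ (Y.restr R).kappa else 0
  simp only [restr_self] at h
  rw [← h, Finset.sum_filter]
  refine Finset.sum_congr rfl fun S hS => ?_
  have h1 := sum_memQP_restr (Y.restr S)
  rw [restr_A (Finset.mem_powerset.1 hS), Finset.sum_filter] at h1
  rw [Finset.sum_congr rfl fun R hR => by rw [restr_restr (Finset.mem_powerset.1 hR)]] at h1
  rw [h1]
  simp

open scoped Classical in
/-- The combinatorial content of the comparison of the quasiplanar with the ordinary Wick product: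
a contraction is, in several ways, the union of an aplanar contraction and an ordinary
contraction of the remaining indices, and the signed number of these ways is `(-1)^κ` on
`C_qp(N)` and zero elsewhere. -/
theorem sum_memQP_eq_sum_join {M : Type*} [AddCommGroup M] [Module ℂ M]
    (Φ : Contraction N → M) :
    ∑ Y : Contraction N with Y.MemQP, (-1 : ℂ) ^ Y.kappa • Φ Y =
      ∑ C : Contraction N with C.IsAplanar, ∑ D : Contraction C.U,
        (-1 : ℂ) ^ D.A.card • Φ (C.join D) := by
  have h1 : ∀ Y : Contraction N, (if Y.MemQP then (-1 : ℂ) ^ Y.kappa • Φ Y else 0) =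
      ∑ S ∈ Y.A.powerset with (Y.restr S).IsAplanar, (-1 : ℂ) ^ (Y.A \ S).card • Φ Y := by
    intro Y
    rw [← Finset.sum_smul]
    have h := congrArg (Int.cast : ℤ → ℂ) (sum_isAplanar_restr Y)
    push_cast at h
    rw [h]
    split_ifs <;> simp
  rw [Finset.sum_filter, Finset.sum_congr rfl fun Y _ => h1 Y, Finset.sum_sigma',
    Finset.sum_sigma']
  symm
  refine Finset.sum_bij (fun p _ => ⟨p.1.join p.2, p.1.A⟩) ?_ ?_ ?_ ?_
  · rintro ⟨C, D⟩ h
    simp only [Finset.mem_sigma, Finset.mem_filter, Finset.mem_univ, true_and, and_true,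
      Finset.mem_powerset, restr_join] at h ⊢
    exact ⟨fun a ha => mem_join_A.2 (Or.inl ha), h⟩
  · rintro ⟨C, D⟩ - ⟨C', D'⟩ - h
    simp only [Sigma.mk.injEq, heq_eq_eq] at h
    obtain rfl : C = C' := by rw [← restr_join C D, h.1, h.2, restr_join]
    obtain rfl : D = D' := by rw [← rest_join C D, h.1, rest_join]
    rfl
  · rintro ⟨Y, S⟩ h
    simp only [Finset.mem_sigma, Finset.mem_filter, Finset.mem_univ, true_and,
      Finset.mem_powerset] at h
    refine ⟨⟨Y.restr S, Y.rest (Y.restr S)⟩, ?_, ?_⟩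
    · simpa using h.2
    · simp only [join_restr_rest, restr_A h.1]
  · rintro ⟨C, D⟩ -
    simp only [card_join_A_sdiff]

end Contraction

/-! ### Weyl correlations and the phases of quantum contractions -/

section Twist

variable (σ : Fin 4 → Fin 4 → ℝ)

theorem twist_neg_left (k l : R4) : twist σ (-k) l = -twist σ k l := by
  simp [twist, lower]

theorem twist_neg_right (k l : R4) : twist σ k (-l) = -twist σ k l := by
  simp [twist, lower]

theorem twist_sum_right {ι : Type*} (s : Finset ι) (k : R4) (l : ι → R4) :
    twist σ k (∑ i ∈ s, l i) = ∑ i ∈ s, twist σ k (l i) := by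
  classical
  induction s using Finset.induction_on with
  | empty => simp [twist_zero_right]
  | insert i s hi ih => rw [Finset.sum_insert hi, Finset.sum_insert hi, twist_add_right, ih]

theorem twist_antisymm {lam : ℝ} (σ : QSpec lam) (k l : R4) :
    twist σ.1 k l = -twist σ.1 l k := by
  simp only [twist]
  rw [Finset.sum_comm, ← Finset.sum_neg_distrib]
  refine Finset.sum_congr rfl fun μ _ => ?_
  rw [← Finset.sum_neg_distrib]
  refine Finset.sum_congr rfl fun ν _ => ?_
  rw [σ.2.1 ν μ]
  ring

theorem twist_self {lam : ℝ} (σ : QSpec lam) (k : R4) : twist σ.1 k k = 0 := by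
  have := twist_antisymm σ k k
  linarith

/-- `∑_{b < b'} k_b σ k_{b'}`, the phase that an ordered product of Weyl operators acquires. -/
def orderedTwist {B : Type*} [LinearOrder B] [Fintype B] (k : B → R4) : ℝ :=
  ∑ b, ∑ b', if b < b' then twist σ (k b) (k b') else 0

theorem prod_expq_neg (n : ℕ) (v : Fin n → R4) :
    (List.ofFn fun j => expq σ (-(v j))).prod =
      ⟨Complex.exp (-(Complex.I / 2) * (orderedTwist σ v : ℂ)), -∑ j, v j⟩ := by
  induction n with
  | zero =>
    simp only [List.ofFn_zero, List.prod_nil, orderedTwist, Finset.univ_eq_empty,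
      Finset.sum_empty, Complex.ofReal_zero, mul_zero, Complex.exp_zero, neg_zero]
    rfl
  | succ n ih =>
    rw [List.ofFn_succ, List.prod_cons, ih fun j => v j.succ]
    apply WeylMonomial.ext
    · change 1 * Complex.exp _ * Complex.exp
        (-(Complex.I / 2) * (twist σ (-(v 0)) (-∑ j : Fin n, v j.succ) : ℂ)) = Complex.exp _
      rw [one_mul, ← Complex.exp_add, ← mul_add]
      congr 2
      rw [← Complex.ofReal_add]
      congr 1
      rw [twist_neg_left, twist_neg_right, neg_neg, twist_sum_right]
      simp only [orderedTwist]
      rw [Fin.sum_univ_succ (n := n), add_comm]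
      congr 1
      · rw [Fin.sum_univ_succ]
        simp [Fin.succ_pos]
      · refine Finset.sum_congr rfl fun i _ => ?_
        rw [Fin.sum_univ_succ]
        simp
    · change -(v 0) + -∑ j : Fin n, v j.succ = -∑ j, v j
      rw [Fin.sum_univ_succ, neg_add]

end Twist

variable {lam : ℝ}

theorem weylCorr_eq (ω : QState lam) (σ : QSpec lam) {B : Type*} [LinearOrder B] [Fintype B]
    (k : B → R4) :
    ω.weylCorr σ k =
      Complex.exp (-(Complex.I / 2) * (orderedTwist σ.1 k : ℂ)) * ω.χ σ (-∑ b, k b) := by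
  have h1 : orderedTwist σ.1 (fun j => k (enum B j)) = orderedTwist σ.1 k := by
    simp only [orderedTwist]
    refine Fintype.sum_equiv (enum B).toEquiv _ _ fun i => ?_
    refine Fintype.sum_equiv (enum B).toEquiv _ _ fun j => ?_
    simp
  have h2 : ∑ j, k (enum B j) = ∑ b, k b :=
    Fintype.sum_equiv (enum B).toEquiv _ _ fun i => rfl
  rw [QState.weylCorr, prod_expq_neg, h1, h2]
  rfl

namespace Contraction

variable {N : Type*} [LinearOrder N] [Fintype N]

theorem assemble_U (C : Contraction N) (kA : C.A → R4) (kU : C.U → R4) (u : C.U) :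
    C.assemble kA kU u = kU u := by
  simp [assemble]

theorem not_mem_U_of_mem_A {C : Contraction N} {a : N} (h : a ∈ C.A) : a ∉ C.U :=
  fun h' => not_line_of_mem_U h' (C.line_α ⟨a, h⟩)

theorem assemble_A (C : Contraction N) (kA : C.A → R4) (kU : C.U → R4) (a : C.A) :
    C.assemble kA kU a = kA a := by
  simp [assemble, not_mem_U_of_mem_A a.2]

theorem α_not_mem_U (C : Contraction N) (a : C.A) : C.α a ∉ C.U :=
  fun h' => not_line_of_mem_U' h' (C.line_α a)

theorem assemble_α (C : Contraction N) (kA : C.A → R4) (kU : C.U → R4) (a : C.A) :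
    C.assemble kA kU (C.α a) = -kA a := by
  have h : ∃ a', C.α a' = C.α a := ⟨a, rfl⟩
  rw [assemble, dif_neg (C.α_not_mem_U a), dif_neg (C.notMem a), dif_pos h,
    C.injective h.choose_spec]

/-- A sum over `N`, split into the left and right endpoints of the lines and the uncontracted
indices. -/
theorem sum_eq (C : Contraction N) {M : Type*} [AddCommMonoid M] (F : N → M) :
    ∑ n, F n = (∑ a : C.A, F a + ∑ a : C.A, F (C.α a)) + ∑ u : C.U, F u := by
  have hd : Disjoint C.A (Finset.univ.image C.α) := by
    rw [Finset.disjoint_left]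
    intro a ha h
    obtain ⟨b, -, rfl⟩ := Finset.mem_image.1 h
    exact C.notMem b ha
  rw [← Finset.sum_add_sum_compl (C.A ∪ Finset.univ.image C.α), Finset.sum_union hd,
    Finset.sum_image fun a _ b _ h => C.injective h]
  congr 1
  · congr 1
    exact (Finset.sum_coe_sort C.A F).symm
  · exact (Finset.sum_coe_sort C.U F).symm

open scoped Classical in
theorem phase_eq (C : Contraction N) (σ : Fin 4 → Fin 4 → ℝ) (kA : C.A → R4)
    (kU : C.U → R4) :
    C.phase σ kA kU =
      (∑ a, ∑ a', if C.Intersects a a' then twist σ (kA a) (kA a') else 0) +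
        ∑ a, ∑ u, if C.Encloses a u then twist σ (kA a) (kU u) else 0 := by
  simp only [phase, dotProduct, Matrix.mulVec, Fintype.sum_prod_type, intersectionMatrix,
    enclosureMatrix]
  congr 1
  all_goals
    refine Finset.sum_congr rfl fun a _ => ?_
    simp only [Finset.mul_sum]
    rw [Finset.sum_comm]
    refine Finset.sum_congr rfl fun b _ => ?_
    split_ifs
    · simp only [twist, mul_assoc]
    · simp

/-- The sign `±1` telling in which order two indices occur, and zero for equal indices. -/
def orderSign (b b' : N) : ℝ := (if b < b' then 1 else 0) - (if b' < b then 1 else 0)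

theorem orderSign_swap {B : Type*} [LinearOrder B] (b b' : B) : orderSign b b' = -orderSign b' b := by
  simp [orderSign]

theorem two_mul_orderedTwist (σ : QSpec lam) (k : N → R4) :
    2 * orderedTwist σ.1 k = ∑ b, ∑ b', orderSign b b' * twist σ.1 (k b) (k b') := by
  have h : orderedTwist σ.1 k = ∑ b, ∑ b', if b' < b then twist σ.1 (k b') (k b) else 0 := by
    rw [orderedTwist, Finset.sum_comm]
  rw [two_mul]
  nth_rewrite 2 [h]
  rw [orderedTwist, ← Finset.sum_add_distrib]
  refine Finset.sum_congr rfl fun b _ => ?_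
  rw [← Finset.sum_add_distrib]
  refine Finset.sum_congr rfl fun b' _ => ?_
  rw [twist_antisymm σ (k b') (k b), orderSign]
  split_ifs <;> ring

open scoped Classical in
/-- Disjoint and nested lines commute, and only crossing lines contribute a phase. -/
theorem orderSign_line_line (C : Contraction N) (a a' : C.A) :
    orderSign (a : N) a' - orderSign (a : N) (C.α a') - orderSign (C.α a) a' +
        orderSign (C.α a) (C.α a') =
      2 * ((if C.Intersects a a' then 1 else 0) - (if C.Intersects a' a then 1 else 0)) := by
  have h1 := C.lt a
  have h2 := C.lt a'
  have h3 : (a : N) ≠ C.α a' := fun h => C.notMem a' (h ▸ a.2)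
  have h4 : (a' : N) ≠ C.α a := fun h => C.notMem a (h ▸ a'.2)
  have h5 : (a : N) = a' ↔ C.α a = C.α a' :=
    ⟨fun h => by rw [Subtype.ext h], fun h => congrArg _ (C.injective h)⟩
  simp only [orderSign, Intersects]
  rcases lt_trichotomy (a : N) a' with hx | hx | hx
  · have hy : C.α a ≠ C.α a' := fun h => hx.ne (h5.2 h)
    rcases lt_or_gt_of_ne hy with hy | hy <;> rcases lt_or_gt_of_ne h4 with hz | hz <;>
      grind
  · obtain rfl := Subtype.ext hx
    grind
  · have hy : C.α a ≠ C.α a' := fun h => hx.ne' (h5.2 h)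
    rcases lt_or_gt_of_ne hy with hy | hy <;> rcases lt_or_gt_of_ne h3 with hz | hz <;>
      grind

open scoped Classical in
theorem orderSign_line_ext (C : Contraction N) (a : C.A) (u : C.U) :
    orderSign (a : N) u - orderSign (C.α a) u = 2 * (if C.Encloses a u then 1 else 0) := by
  have h1 := C.lt a
  have h2 : (a : N) ≠ u := fun h => not_mem_U_of_mem_A a.2 (h ▸ u.2)
  have h3 : C.α a ≠ u := fun h => C.α_not_mem_U a (h ▸ u.2)
  simp only [orderSign, Encloses]
  rcases lt_or_gt_of_ne h2 with h | h <;> rcases lt_or_gt_of_ne h3 with h' | h' <;> grind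

/-- Moving the Weyl operators of each line next to each other: the phases of crossing lines and of
crossed uncontracted indices are those of the quantum contraction. -/
theorem orderedTwist_assemble (C : Contraction N) (σ : QSpec lam) (kA : C.A → R4)
    (kU : C.U → R4) :
    orderedTwist σ.1 (C.assemble kA kU) = orderedTwist σ.1 kU + 2 * C.phase σ.1 kA kU := by
  classical
  -- In terms of signs the sum over ordered pairs extends over all pairs, and splits over the three
  -- kinds of indices; opposite momenta at the ends of a line combine the signs of both ends.
  have hsum : 2 * orderedTwist σ.1 (C.assemble kA kU) =
      (∑ a : C.A, ∑ a' : C.A, (orderSign (a : N) a' - orderSign (a : N) (C.α a') -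
        orderSign (C.α a) a' + orderSign (C.α a) (C.α a')) * twist σ.1 (kA a) (kA a')) +
      2 * (∑ a : C.A, ∑ u : C.U, (orderSign (a : N) u - orderSign (C.α a) u) *
        twist σ.1 (kA a) (kU u)) + 2 * orderedTwist σ.1 kU := by
    have hU : ∑ u : C.U, ∑ a : C.A, (orderSign (u : N) a - orderSign (u : N) (C.α a)) *
        twist σ.1 (kU u) (kA a) = ∑ a : C.A, ∑ u : C.U,
          (orderSign (a : N) u - orderSign (C.α a) u) * twist σ.1 (kA a) (kU u) := by
      rw [Finset.sum_comm]
      refine Finset.sum_congr rfl fun a _ => Finset.sum_congr rfl fun u _ => ?_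
      rw [orderSign_swap (u : N) a, orderSign_swap (u : N) (C.α a),
        twist_antisymm σ (kU u) (kA a)]
      ring
    rw [two_mul_orderedTwist σ kU, two_mul (∑ a : C.A, ∑ u : C.U, _)]
    nth_rewrite 1 [← hU]
    rw [two_mul_orderedTwist, C.sum_eq]
    simp only [C.sum_eq (fun b' => orderSign _ b' * _), assemble_U, assemble_A, assemble_α,
      twist_neg_left, twist_neg_right, sub_mul, add_mul, Finset.sum_add_distrib,
      Finset.sum_sub_distrib, mul_neg, Finset.sum_neg_distrib]
    simp only [orderSign, Subtype.coe_lt_coe]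
    ring
  have hI : ∑ a, ∑ a', (2 * ((if C.Intersects a a' then 1 else 0) -
        (if C.Intersects a' a then 1 else 0))) * twist σ.1 (kA a) (kA a') =
      4 * ∑ a, ∑ a', if C.Intersects a a' then twist σ.1 (kA a) (kA a') else 0 := by
    have hs : ∑ a, ∑ a', (if C.Intersects a a' then twist σ.1 (kA a) (kA a') else 0) =
        ∑ a, ∑ a', if C.Intersects a' a then twist σ.1 (kA a') (kA a) else 0 :=
      Finset.sum_comm
    rw [show (4 : ℝ) = 2 + 2 by norm_num, add_mul]
    nth_rewrite 2 [hs]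
    simp only [Finset.mul_sum, ← Finset.sum_add_distrib]
    refine Finset.sum_congr rfl fun a _ => Finset.sum_congr rfl fun a' _ => ?_
    rw [twist_antisymm σ (kA a') (kA a)]
    split_ifs <;> ring
  have hE : ∑ a, ∑ u, (2 * (if C.Encloses a u then 1 else 0)) * twist σ.1 (kA a) (kU u) =
      2 * ∑ a, ∑ u, if C.Encloses a u then twist σ.1 (kA a) (kU u) else 0 := by
    simp only [Finset.mul_sum]
    refine Finset.sum_congr rfl fun a _ => Finset.sum_congr rfl fun u _ => ?_
    split_ifs <;> ring
  simp only [orderSign_line_line, orderSign_line_ext, hI, hE] at hsum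
  rw [phase_eq]
  linarith

theorem sum_assemble (C : Contraction N) (kA : C.A → R4) (kU : C.U → R4) :
    ∑ n, C.assemble kA kU n = ∑ u, kU u := by
  rw [C.sum_eq]
  simp [assemble_U, assemble_A, assemble_α]

/-- The phase of the quantum contraction turns the Weyl correlation of the uncontracted momenta into
that of all momenta, evaluated at opposite momenta on the ends of each line. -/
theorem weylCorr_mul_exp_phase (C : Contraction N) (ω : QState lam) (σ : QSpec lam)
    (kA : C.A → R4) (kU : C.U → R4) :
    ω.weylCorr σ kU * Complex.exp (-Complex.I * (C.phase σ.1 kA kU : ℂ)) =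
      ω.weylCorr σ (C.assemble kA kU) := by
  rw [weylCorr_eq, weylCorr_eq, orderedTwist_assemble, sum_assemble, mul_right_comm,
    ← Complex.exp_add]
  congr 2
  push_cast
  ring

end Contraction

/-! ### Bounds and measurability of Weyl correlations -/

namespace QState

variable (ω : QState lam) (σ : QSpec lam)

theorem χ_zero : ω.χ σ 0 = 1 := by
  have h := ω.unital σ
  change 1 * ω.χ σ 0 = 1 at h
  rwa [one_mul] at h

/-- Positivity on the span of `1` and `e^{ikq}`. -/
theorem positive_pair (k : R4) (c d : ℂ) :
    ∃ r : ℝ, 0 ≤ r ∧ star c * c + star c * d * ω.χ σ k + star d * c * ω.χ σ (-k) + star d * d =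
      (r : ℂ) := by
  obtain ⟨r, hr, h⟩ := ω.positive σ 2 ![c, d] ![0, k]
  refine ⟨r, hr, ?_⟩
  have hmul : ∀ k l : R4, evalWeyl (ω.χ σ) (star (expq σ.1 k) * expq σ.1 l) =
      Complex.exp (-(Complex.I / 2) * (twist σ.1 (-k) l : ℂ)) * ω.χ σ (-k + l) := by
    intro k l
    change star (1 : ℂ) * 1 * _ * _ = _
    rw [star_one, one_mul, one_mul]
    rfl
  simp only [hmul, Fin.sum_univ_two, Matrix.cons_val_zero, Matrix.cons_val_one, neg_zero,
    twist_zero_left, twist_zero_right, twist_neg_left, twist_self, add_zero, zero_add,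
    neg_add_cancel, χ_zero, Complex.ofReal_zero, mul_zero, Complex.exp_zero, mul_one,
    one_mul] at h
  rw [← h]
  ring

theorem χ_neg (k : R4) : ω.χ σ (-k) = star (ω.χ σ k) := by
  -- That `ω(A* A)` is real for `A = 1 + e^{ikq}` and for `A = 1 + i e^{ikq}` gives the claim.
  obtain ⟨r, -, h⟩ := ω.positive_pair σ k 1 1
  obtain ⟨s, -, h'⟩ := ω.positive_pair σ k 1 Complex.I
  have h1 := congrArg Complex.im h
  have h2 := congrArg Complex.im h'
  simp at h1 h2
  apply Complex.ext <;> simp <;> linarith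

theorem norm_χ_le (k : R4) : ‖ω.χ σ k‖ ≤ 1 := by
  -- For `A = e^{ikq} - ω(e^{ikq})`, positivity of `A* A` reads `0 ≤ 1 - |ω(e^{ikq})|²`.
  obtain ⟨r, hr, h⟩ := ω.positive_pair σ k (-ω.χ σ k) 1
  rw [χ_neg] at h
  have h1 : star (ω.χ σ k) * ω.χ σ k = ((‖ω.χ σ k‖ ^ 2 : ℝ) : ℂ) := by
    rw [Complex.star_def, Complex.conj_mul', Complex.ofReal_pow]
  have h2 : ((1 - ‖ω.χ σ k‖ ^ 2 : ℝ) : ℂ) = r := by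
    rw [← h, Complex.ofReal_sub, ← h1]
    simp
    ring
  have h3 : 1 - ‖ω.χ σ k‖ ^ 2 = r := by exact_mod_cast h2
  nlinarith [norm_nonneg (ω.χ σ k)]

theorem norm_weylCorr_le {B : Type*} [LinearOrder B] [Fintype B] (k : B → R4) :
    ‖ω.weylCorr σ k‖ ≤ 1 := by
  have h : -(Complex.I / 2) * (orderedTwist σ.1 k : ℂ) =
      ((-(orderedTwist σ.1 k) / 2 : ℝ) : ℂ) * Complex.I := by
    push_cast
    ring
  rw [weylCorr_eq, norm_mul, h, Complex.norm_exp_ofReal_mul_I, one_mul]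
  exact ω.norm_χ_le σ _

theorem measurable_weylCorr {B : Type*} [LinearOrder B] [Fintype B] :
    Measurable fun x : QSpec lam × (B → R4) => ω.weylCorr x.1 x.2 := by
  simp only [weylCorr_eq]
  refine Measurable.mul ?_ ?_
  · refine Continuous.measurable ?_
    unfold orderedTwist twist lower
    refine Complex.continuous_exp.comp (continuous_const.mul (Complex.continuous_ofReal.comp ?_))
    have hσ : ∀ μ ν, Continuous fun x : QSpec lam × (B → R4) => x.1.1 μ ν := fun μ ν =>
      (continuous_apply_apply μ ν).comp (continuous_subtype_val.comp continuous_fst)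
    have hk : ∀ b μ, Continuous fun x : QSpec lam × (B → R4) => x.2 b μ := fun b μ =>
      (continuous_apply_apply b μ).comp continuous_snd
    refine continuous_finsetSum _ fun b _ => continuous_finsetSum _ fun b' _ => ?_
    split_ifs
    · exact continuous_finsetSum _ fun μ _ => continuous_finsetSum _ fun ν _ =>
        ((continuous_const.mul (hk b μ)).mul (hσ μ ν)).mul (continuous_const.mul (hk b' ν))
    · exact continuous_const
  · have h : Measurable (Function.uncurry fun (k : R4) (σ : QSpec lam) => ω.χ σ k) :=
      MeasureTheory.measurable_uncurry_of_continuous_of_measurable ω.regular ω.measurable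
    exact h.comp (f := fun x : QSpec lam × (B → R4) => (-∑ b, x.2 b, x.1)) (by fun_prop)

end QState

/-! ### Decay of test functions in momentum space -/

section Decay

variable {N : Type*} [Fintype N]

/-- The coordinates of Euclidean space of dimension `4 |N|`, grouped into four-vectors. -/
def groupCoords (N : Type*) [Fintype N] : EuclideanSpace ℝ (N × Fin 4) ≃L[ℝ] (N → R4) :=
  ((WithLp.linearEquiv 2 ℝ (N × Fin 4 → ℝ)).trans
    (LinearEquiv.curry ℝ ℝ N (Fin 4))).toContinuousLinearEquiv

theorem groupCoords_apply (v : EuclideanSpace ℝ (N × Fin 4)) (b : N) (μ : Fin 4) :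
    groupCoords N v b μ = v (b, μ) := rfl

theorem eta_mul_eta (μ : Fin 4) : eta μ * eta μ = 1 := by
  fin_cases μ <;> simp [eta]

/-- Lowering of indices, with the factor `1 / 2π` that relates `invFourier` to the Fourier
transform of Mathlib. -/
def lowerFrequency (N : Type*) [Fintype N] : (N → R4) ≃L[ℝ] EuclideanSpace ℝ (N × Fin 4) :=
  LinearEquiv.toContinuousLinearEquiv
    { toFun := fun k => WithLp.toLp 2 fun x => (2 * Real.pi)⁻¹ * (eta x.2 * k x.1 x.2)
      invFun := fun v b μ => 2 * Real.pi * (eta μ * v (b, μ))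
      map_add' := fun k l => by
        ext x
        simp [mul_add]
      map_smul' := fun c k => by
        ext x
        simp
        ring
      left_inv := fun k => by
        funext b μ
        have h : 2 * Real.pi * (2 * Real.pi)⁻¹ = 1 := mul_inv_cancel₀ (by positivity)
        linear_combination (2 * Real.pi * (2 * Real.pi)⁻¹ * k b μ) * eta_mul_eta μ + k b μ * h
      right_inv := fun v => by
        ext x
        have h : 2 * Real.pi * (2 * Real.pi)⁻¹ = 1 := mul_inv_cancel₀ (by positivity)
        change (2 * Real.pi)⁻¹ * (eta x.2 * (2 * Real.pi * (eta x.2 * v x))) = v x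
        linear_combination (2 * Real.pi * (2 * Real.pi)⁻¹ * v x) * eta_mul_eta x.2 + v x * h }

theorem lowerFrequency_apply (k : N → R4) (x : N × Fin 4) :
    lowerFrequency N k x = (2 * Real.pi)⁻¹ * (eta x.2 * k x.1 x.2) := rfl

/-- Lebesgue measure of four-vectors agrees with that of Euclidean space up to a constant. -/
theorem exists_integral_eq_groupCoords :
    ∃ c : ℝ, ∀ F : (N → R4) → ℂ, ∫ x, F x = c • ∫ v, F (groupCoords N v) := by
  have := (groupCoords N).isAddHaarMeasure_map MeasureTheory.volume
  refine ⟨MeasureTheory.Measure.addHaarScalarFactor MeasureTheory.volume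
    (MeasureTheory.Measure.map (groupCoords N) MeasureTheory.volume), fun F => ?_⟩
  conv_lhs =>
    rw [MeasureTheory.Measure.isAddLeftInvariant_eq_smul
      (MeasureTheory.volume : MeasureTheory.Measure (N → R4))
      (MeasureTheory.Measure.map (groupCoords N) MeasureTheory.volume)]
  have hemb : MeasurableEmbedding (groupCoords N) :=
    (groupCoords N).toHomeomorph.measurableEmbedding
  rw [MeasureTheory.integral_smul_nnreal_measure, hemb.integral_map]
  rfl

open scoped FourierTransform in
/-- The inverse Fourier transform of a Schwartz function is a Schwartz function. -/
theorem exists_schwartzMap_eq_invFourier (f : SchwartzMap (N → R4) ℂ) :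
    ∃ g : SchwartzMap (N → R4) ℂ, invFourier f = g := by
  obtain ⟨c, hc⟩ := exists_integral_eq_groupCoords (N := N)
  let fE := SchwartzMap.compCLMOfContinuousLinearEquiv ℂ (groupCoords N) f
  refine ⟨(((2 * Real.pi : ℝ) : ℂ) ^ (-(4 * (Fintype.card N : ℤ))) * c) •
    SchwartzMap.compCLMOfContinuousLinearEquiv ℂ (lowerFrequency N) (𝓕 fE), ?_⟩
  funext k
  rw [invFourier, hc, smul_apply, smul_eq_mul, mul_assoc]
  congr 1
  rw [Complex.real_smul]
  congr 1
  rw [SchwartzMap.compCLMOfContinuousLinearEquiv_apply, Function.comp_apply,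
    SchwartzMap.fourier_coe, Real.fourier_eq]
  refine MeasureTheory.integral_congr_ae (Filter.Eventually.of_forall fun v => ?_)
  have hin : 2 * Real.pi * -inner ℝ v (lowerFrequency N k) =
      -∑ b, mdot (k b) (groupCoords N v b) := by
    rw [PiLp.inner_apply, Fintype.sum_prod_type, mul_neg, Finset.mul_sum]
    congr 1
    refine Finset.sum_congr rfl fun b _ => ?_
    rw [Finset.mul_sum, mdot]
    refine Finset.sum_congr rfl fun μ _ => ?_
    rw [lowerFrequency_apply, groupCoords_apply, lower]
    have h : 2 * Real.pi * (2 * Real.pi)⁻¹ = 1 := mul_inv_cancel₀ (by positivity)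
    change 2 * Real.pi * (((2 * Real.pi)⁻¹ * (eta μ * k b μ)) * v (b, μ)) = _
    linear_combination (eta μ * k b μ * v (b, μ)) * h
  change f (groupCoords N v) * _ = Real.fourierChar _ • f (groupCoords N v)
  rw [Circle.smul_def, Real.fourierChar_apply, hin, smul_eq_mul, mul_comm]
  congr 2
  push_cast
  ring

/-- Decay of a Schwartz function in a family of vectors that are bounded by its argument; the exponent
is chosen so that each factor is integrable in three dimensions. -/
theorem norm_schwartzMap_le_prod {E ι F : Type*} [NormedAddCommGroup E] [NormedSpace ℝ E]
    [Fintype ι] [NormedAddCommGroup F] (g : SchwartzMap E ℂ) :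
    ∃ c : ℝ, ∀ (x : E) (p : ι → F), (∀ i, ‖p i‖ ≤ ‖x‖) →
      ‖g x‖ ≤ c * ∏ i, (1 + ‖p i‖) ^ (-4 : ℝ) := by
  refine ⟨2 ^ (4 * Fintype.card ι) * ((Finset.Iic (4 * Fintype.card ι, 0)).sup
    fun m => SchwartzMap.seminorm ℝ m.1 m.2) g, fun x p hp => ?_⟩
  have h := SchwartzMap.one_add_le_sup_seminorm_apply (𝕜 := ℝ)
    (m := (4 * Fintype.card ι, 0)) le_rfl le_rfl g x
  rw [norm_iteratedFDeriv_zero] at h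
  have hprod : ∏ i, (1 + ‖p i‖) ^ (-4 : ℝ) = (∏ i, (1 + ‖p i‖) ^ 4)⁻¹ := by
    rw [← Finset.prod_inv_distrib]
    refine Finset.prod_congr rfl fun i _ => ?_
    rw [Real.rpow_neg (by positivity)]
    norm_cast
  have hle : ∏ i, (1 + ‖p i‖) ^ 4 ≤ (1 + ‖x‖) ^ (4 * Fintype.card ι) := by
    calc ∏ i, (1 + ‖p i‖) ^ 4 ≤ ∏ _i : ι, (1 + ‖x‖) ^ 4 := by
          refine Finset.prod_le_prod (fun i _ => by positivity) fun i _ => ?_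
          gcongr
          exact hp i
      _ = _ := by rw [Finset.prod_const, Finset.card_univ, pow_mul]
  have hpos : 0 < ∏ i, (1 + ‖p i‖) ^ 4 := Finset.prod_pos fun i _ => by positivity
  rw [hprod, ← div_eq_mul_inv, le_div_iff₀ hpos, mul_comm]
  exact (mul_le_mul_of_nonneg_right hle (norm_nonneg _)).trans h

end Decay

/-! ### Integration over the mass shell -/

open MeasureTheory

instance (m : ℝ) : SigmaFinite (shell m) := SigmaFinite.withDensity_ofReal _

theorem le_energy (m : ℝ) (p : R3) : m ≤ energy m p := by
  refine Real.le_sqrt_of_sq_le ?_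
  have : 0 ≤ ∑ i, p i ^ 2 := Finset.sum_nonneg fun i _ => sq_nonneg _
  linarith

theorem integrable_shell {m : ℝ} (hm : 0 < m) :
    Integrable (fun p : R3 => (1 + ‖p‖) ^ (-4 : ℝ)) (shell m) := by
  have h1 : Integrable (fun p : R3 => (1 + ‖p‖) ^ (-4 : ℝ)) volume :=
    integrable_one_add_norm (by simp; norm_num)
  have h2 : shell m ≤ ENNReal.ofReal ((2 * Real.pi) ^ (-3 : ℤ) * (1 / (2 * m))) • volume := by
    rw [← withDensity_const]
    refine withDensity_mono (Filter.Eventually.of_forall fun p => ENNReal.ofReal_le_ofReal ?_)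
    have := le_energy m p
    gcongr
  exact (h1.smul_measure ENNReal.ofReal_ne_top).mono_measure h2

theorem continuous_onShell (m : ℝ) : Continuous (onShell m) := by
  refine continuous_pi fun μ => ?_
  refine Fin.cases ?_ (fun i => ?_) μ
  · simp only [onShell, Fin.cons_zero, energy]
    fun_prop
  · simp only [onShell, Fin.cons_succ]
    fun_prop

theorem norm_le_onShell (m : ℝ) (p : R3) : ‖p‖ ≤ ‖onShell m p‖ :=
  (pi_norm_le_iff_of_nonneg (norm_nonneg _)).2 fun i => norm_le_pi_norm (onShell m p) i.succ

namespace Contraction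

variable {N : Type*} [LinearOrder N] [Fintype N]

theorem eq_endpoint_or_mem_U (C : Contraction N) (n : N) :
    (∃ u : C.U, (u : N) = n) ∨ (∃ a : C.A, (a : N) = n) ∨ ∃ a : C.A, C.α a = n := by
  by_cases h : n ∈ C.U
  · exact Or.inl ⟨⟨n, h⟩, rfl⟩
  · obtain ⟨b, h | h⟩ := not_mem_U h
    · exact Or.inr (Or.inl ⟨⟨n, h.mem⟩, rfl⟩)
    · exact Or.inr (Or.inr ⟨⟨b, h.mem⟩, h.α_eq _⟩)

theorem continuous_assemble (C : Contraction N) (kU : C.U → R4) :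
    Continuous fun kA : C.A → R4 => C.assemble kA kU := by
  refine continuous_pi fun n => ?_
  rcases C.eq_endpoint_or_mem_U n with ⟨u, rfl⟩ | ⟨a, rfl⟩ | ⟨a, rfl⟩
  · simp only [assemble_U]
    exact continuous_const
  · simp only [assemble_A]
    exact continuous_apply a
  · simp only [assemble_α]
    exact (continuous_apply a).neg

/-- The momenta of all indices, if the lines carry on-shell momenta. -/
def shellAssemble (C : Contraction N) (m : ℝ) (kU : C.U → R4) (p : C.A → R3) : N → R4 :=
  C.assemble (fun a => onShell m (p a)) kU

theorem measurable_shellAssemble (C : Contraction N) (m : ℝ) (kU : C.U → R4) :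
    Measurable (C.shellAssemble m kU) :=
  ((C.continuous_assemble kU).comp (continuous_pi fun a =>
    (continuous_onShell m).comp (continuous_apply a))).measurable

/-- A measurable function that is dominated by a Schwartz function is integrable over the momenta of
the lines, because a line momentum is bounded by the spatial momenta of its ends. -/
theorem integrable_shellAssemble (C : Contraction N) {m : ℝ} (hm : 0 < m) (kU : C.U → R4)
    {H : (N → R4) → ℂ} (hH : Measurable H) (g : SchwartzMap (N → R4) ℂ)
    (hg : ∀ k, ‖H k‖ ≤ ‖g k‖) :
    Integrable (fun p => H (C.shellAssemble m kU p)) (Measure.pi fun _ => shell m) := by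
  obtain ⟨c, hc⟩ := norm_schwartzMap_le_prod (ι := C.A) (F := R3) g
  have h1 : Integrable (fun p : C.A → R3 => ∏ a, (1 + ‖p a‖) ^ (-4 : ℝ))
      (Measure.pi fun _ => shell m) :=
    Integrable.fintype_prod (μ := fun _ => shell m)
      (f := fun (_ : C.A) (p : R3) => (1 + ‖p‖) ^ (-4 : ℝ)) fun _ => integrable_shell hm
  refine (h1.const_mul c).mono'
    (hH.comp (C.measurable_shellAssemble m kU)).aestronglyMeasurable
    (Filter.Eventually.of_forall fun p => (hg _).trans (hc _ _ fun a => ?_))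
  refine (norm_le_onShell m (p a)).trans ?_
  have h := norm_le_pi_norm (C.shellAssemble m kU p) (a : N)
  rwa [shellAssemble, assemble_A] at h

end Contraction

/-! ### Quantum contractions as ordinary contractions -/

variable {N : Type*} [LinearOrder N] [Fintype N]

theorem measurable_wignerConv (ω : QState lam) (g : SchwartzMap (N → R4) ℂ) :
    Measurable (ω.wignerConv fun _ => g) := by
  have := ω.isProb
  have h : StronglyMeasurable (Function.uncurry fun (σ : QSpec lam) (k : N → R4) =>
      ω.weylCorr σ k * g k) :=
    ((ω.measurable_weylCorr (B := N)).mul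
      (g.continuous.measurable.comp measurable_snd)).stronglyMeasurable
  exact (h.integral_prod_left (μ := ω.μ)).measurable

theorem norm_wignerConv_le (ω : QState lam) (g : (N → R4) → ℂ) (k : N → R4) :
    ‖ω.wignerConv (fun _ => g) k‖ ≤ ‖g k‖ := by
  have := ω.isProb
  refine (norm_integral_le_of_norm_le_const (C := ‖g k‖)
    (Filter.Eventually.of_forall fun σ => ?_)).trans ?_
  · rw [norm_mul]
    exact mul_le_of_le_one_left (norm_nonneg _) (ω.norm_weylCorr_le σ k)
  · simp

/-- In every state, the quantum contraction of a test function is the ordinary contraction of the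
function smeared with the Weyl correlations of all variables. -/
theorem wignerConv_gamma (ω : QState lam) {m : ℝ} (hm : 0 < m) (C : Contraction N)
    (g : SchwartzMap (N → R4) ℂ) :
    ω.wignerConv (fun σ => C.gamma m g σ.1) = C.gamma0 m (ω.wignerConv fun _ => g) := by
  have := ω.isProb
  funext kU
  have hint : Integrable (Function.uncurry fun (σ : QSpec lam) (p : C.A → R3) =>
      ω.weylCorr σ (C.shellAssemble m kU p) * g (C.shellAssemble m kU p))
      (ω.μ.prod (Measure.pi fun _ => shell m)) := by
    have h1 := C.integrable_shellAssemble hm kU g.continuous.measurable g fun _ => le_rfl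
    have hS : Measurable fun x : QSpec lam × (C.A → R3) => C.shellAssemble m kU x.2 :=
      (C.measurable_shellAssemble m kU).comp measurable_snd
    refine (h1.comp_snd ω.μ).norm.mono' ?_ (Filter.Eventually.of_forall fun x => ?_)
    · exact ((ω.measurable_weylCorr.comp (measurable_fst.prodMk hS)).mul
        (g.continuous.measurable.comp hS)).aestronglyMeasurable
    · rw [Function.uncurry, norm_mul]
      exact mul_le_of_le_one_left (norm_nonneg _) (ω.norm_weylCorr_le x.1 _)
  have hpt : ∀ σ : QSpec lam, ω.weylCorr σ kU * C.gamma m g σ.1 kU =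
      ((2 * Real.pi : ℝ) : ℂ) ^ (8 * C.A.card) * ∫ p : C.A → R3,
        ω.weylCorr σ (C.shellAssemble m kU p) * g (C.shellAssemble m kU p)
          ∂(Measure.pi fun _ => shell m) := by
    intro σ
    rw [Contraction.gamma, mul_left_comm, ← integral_const_mul]
    simp only [← mul_assoc, Contraction.weylCorr_mul_exp_phase]
    rfl
  rw [QState.wignerConv, Contraction.gamma0]
  simp only [hpt]
  rw [integral_const_mul, integral_integral_swap hint]
  rfl

namespace Contraction

/-- The lines of a joint contraction are those of its two parts. -/
def joinLines (C : Contraction N) (D : Contraction C.U) : C.A ⊕ D.A ≃ (C.join D).A :=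
  Equiv.ofBijective
    (Sum.elim (fun a => ⟨a, mem_join_A.2 (Or.inl a.2)⟩)
      fun d => ⟨d.1.1, mem_join_A.2 (Or.inr ⟨d, d.2, rfl⟩)⟩) <| by
    constructor
    · rintro (a | d) (a' | d') h
      · exact congrArg Sum.inl (Subtype.ext (Subtype.mk.inj h))
      · exact absurd d'.1.2 (not_mem_U_of_mem_A (congrArg Subtype.val h ▸ a.2))
      · exact absurd d.1.2 (not_mem_U_of_mem_A (congrArg Subtype.val h ▸ a'.2))
      · exact congrArg Sum.inr (Subtype.ext (Subtype.ext (Subtype.mk.inj h)))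
    · rintro ⟨n, hn⟩
      rcases mem_join_A.1 hn with h | ⟨u, hu, rfl⟩
      · exact ⟨Sum.inl ⟨n, h⟩, rfl⟩
      · exact ⟨Sum.inr ⟨u, hu⟩, rfl⟩

/-- The indices left uncontracted by a joint contraction. -/
def joinU (C : Contraction N) (D : Contraction C.U) : D.U ≃o (C.join D).U :=
  StrictMono.orderIsoOfSurjective (fun u => ⟨u.1.1, mem_join_U.2 ⟨u, u.2, rfl⟩⟩)
    (fun _ _ h => h) <| by
    rintro ⟨n, hn⟩
    obtain ⟨u, hu, rfl⟩ := mem_join_U.1 hn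
    exact ⟨⟨u, hu⟩, rfl⟩

theorem assemble_join (C : Contraction N) (D : Contraction C.U) (kA : (C.join D).A → R4)
    (kU : (C.join D).U → R4) :
    (C.join D).assemble kA kU =
      C.assemble (fun a => kA (C.joinLines D (Sum.inl a)))
        (D.assemble (fun d => kA (C.joinLines D (Sum.inr d))) fun u => kU (C.joinU D u)) := by
  have hA : ∀ a : (C.join D).A, ∀ n : N, (C.join D).Line a n →
      (C.join D).assemble kA kU n = -kA a := fun a n h => by
    rw [← h.α_eq a.2, assemble_α]
  funext n
  rcases C.eq_endpoint_or_mem_U n with ⟨u, rfl⟩ | ⟨a, rfl⟩ | ⟨a, rfl⟩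
  · rw [assemble_U]
    rcases D.eq_endpoint_or_mem_U u with ⟨v, rfl⟩ | ⟨d, rfl⟩ | ⟨d, rfl⟩
    · rw [assemble_U]
      exact assemble_U (C.join D) kA kU (C.joinU D v)
    · rw [assemble_A]
      exact assemble_A (C.join D) kA kU (C.joinLines D (Sum.inr d))
    · rw [assemble_α]
      exact hA (C.joinLines D (Sum.inr d)) _ (join_line_coe.2 (D.line_α d))
  · rw [assemble_A]
    exact assemble_A (C.join D) kA kU (C.joinLines D (Sum.inl a))
  · rw [assemble_α]
    exact hA (C.joinLines D (Sum.inl a)) _ (join_line.2 (Or.inl (C.line_α a)))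

/-- Ordinary contraction maps compose. -/
theorem gamma0_gamma0 (C : Contraction N) (D : Contraction C.U) {m : ℝ} (hm : 0 < m)
    {H : (N → R4) → ℂ} (hH : Measurable H) (g : SchwartzMap (N → R4) ℂ)
    (hg : ∀ k, ‖H k‖ ≤ ‖g k‖) (kU : (C.join D).U → R4) :
    (C.join D).gamma0 m H kU = D.gamma0 m (C.gamma0 m H) fun u => kU (C.joinU D u) := by
  have hcard : (C.join D).A.card = D.A.card + C.A.card := by
    have := Fintype.card_congr (C.joinLines D)
    rw [Fintype.card_sum, Fintype.card_coe, Fintype.card_coe, Fintype.card_coe] at this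
    omega
  have hint := (C.join D).integrable_shellAssemble hm kU hH g hg
  let e1 := MeasurableEquiv.sumPiEquivProdPi fun _ : C.A ⊕ D.A => R3
  let e2 := MeasurableEquiv.piCongrLeft (fun _ : (C.join D).A => R3) (C.joinLines D)
  have h1 : MeasurePreserving e1.symm ((Measure.pi fun _ : C.A => shell m).prod
      (Measure.pi fun _ : D.A => shell m)) (Measure.pi fun _ => shell m) :=
    (measurePreserving_sumPiEquivProdPi fun _ : C.A ⊕ D.A => shell m).symm
  have h2 : MeasurePreserving e2 (Measure.pi fun _ => shell m) (Measure.pi fun _ => shell m) :=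
    measurePreserving_piCongrLeft (fun _ : (C.join D).A => shell m) (C.joinLines D)
  have h12 := h2.comp h1
  have hemb : MeasurableEmbedding (e2 ∘ e1.symm) :=
    e2.measurableEmbedding.comp e1.symm.measurableEmbedding
  have hval : ∀ x : (C.A → R3) × (D.A → R3), (C.join D).shellAssemble m kU ((e2 ∘ e1.symm) x) =
      C.shellAssemble m (D.shellAssemble m (fun u => kU (C.joinU D u)) x.2) x.1 := by
    intro x
    have hl : ∀ i, (e2 ∘ e1.symm) x (C.joinLines D i) = e1.symm x i := fun i =>
      Equiv.piCongrLeft_apply_apply (fun _ : (C.join D).A => R3) (C.joinLines D) (e1.symm x) i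
    rw [shellAssemble, assemble_join]
    simp only [hl]
    rfl
  rw [← h12.integrable_comp_emb hemb] at hint
  have hint' := h12.integral_comp hemb fun p => H ((C.join D).shellAssemble m kU p)
  simp only [hval] at hint'
  have hint2 : Integrable (fun x : (C.A → R3) × (D.A → R3) => H (C.shellAssemble m
      (D.shellAssemble m (fun u => kU (C.joinU D u)) x.2) x.1))
      ((Measure.pi fun _ => shell m).prod (Measure.pi fun _ => shell m)) := by
    refine hint.congr (Filter.Eventually.of_forall fun x => ?_)
    simp only [Function.comp_apply, ← hval x]
  rw [integral_prod_symm _ hint2] at hint'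
  simp only [gamma0]
  rw [integral_const_mul, hcard, mul_add, pow_add, mul_assoc]
  congr 2
  exact hint'.symm

end Contraction

theorem phiTensor_eq (m : ℝ) {B : Type*} [LinearOrder B] [Fintype B] (g : (B → R4) → ℂ) {n : ℕ}
    (e : Fin n ≃o B) :
    phiTensor m B g = fun ψ => smear m n fun k j p => g (fun b => k (e.symm b)) * ψ.comp j p := by
  obtain rfl : Fintype.card B = n := by simpa using (Fintype.card_congr e.toEquiv).symm
  rw [Subsingleton.elim e (enum B)]
  rfl

theorem phiTensor_orderIso (m : ℝ) {B B' : Type*} [LinearOrder B] [Fintype B] [LinearOrder B']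
    [Fintype B'] (e : B ≃o B') (g : (B → R4) → ℂ) :
    phiTensor m B g = phiTensor m B' fun k => g fun b => k (e b) := by
  rw [phiTensor_eq m (fun k : B' → R4 => g fun b => k (e b)) ((enum B).trans e)]
  simp only [OrderIso.symm_trans_apply, OrderIso.symm_apply_apply]
  rfl

end NCWick

end

open scoped Classical in
theorem mainTheorem3 (lam m : ℝ) (hlam : 0 < lam) (hm : 0 < m)
    (N : Type*) [LinearOrder N] [Fintype N]
    (f : SchwartzMap (N → NCWick.R4) ℂ) (ω : NCWick.QState lam) :
    ω.qpWick m f =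
      ∑ C : NCWick.Contraction N with C.IsAplanar,
        ω.wick m C.U (fun σ => C.gamma m (NCWick.invFourier f) σ.1) := by
  obtain ⟨g, hg⟩ := NCWick.exists_schwartzMap_eq_invFourier f
  -- Every term becomes an ordinary contraction of one and the same function of all momenta.
  simp only [NCWick.QState.qpWick, NCWick.QState.phi, NCWick.QState.wick, NCWick.wickTensor, hg,
    NCWick.wignerConv_gamma ω hm]
  rw [NCWick.Contraction.sum_memQP_eq_sum_join fun Y =>
    NCWick.phiTensor m Y.U (Y.gamma0 m (ω.wignerConv fun _ => g))]
  refine Finset.sum_congr rfl fun C _ => Finset.sum_congr rfl fun D _ => ?_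
  congr 1
  rw [NCWick.phiTensor_orderIso m (C.joinU D)]
  congr 1
  funext kU
  exact C.gamma0_gamma0 D hm (NCWick.measurable_wignerConv ω g) g
    (NCWick.norm_wignerConv_le ω g) kU
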